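/- **Automata.** Let $\Sigma=\{0,1\}$, $\Sigma_\star=\{\star,0,1\}$ and $k\ge 1$. A two-way nondeterministic automaton $M$ with $k$ heads consists of a finite set $Q$ with three distinct states $\mathrm{init},\mathrm{accept},\mathrm{reject}$ and a relation $\to\ \subseteq(\Sigma_\star^k\times Q)\times((\{1,\dots,k\}\times\{\mathrm{in},\mathrm{out}\})\times Q)$. A word $w=a_1\cdots a_n\in\Sigma^*$ is read as the circular word $\star a_1\cdots a_n$ with positions $0,\dots,n$ modulo $n+1$ and $a_0=\star$. A computation starts in $\mathrm{init}$ with all heads at position $0$. In a state $q\ne\mathrm{accept},\mathrm{reject}$ with heads at $p_1,\dots,p_k$, a transition $((\vec s,q),(i,d,q'))$ with $\vec s=(a_{p_1},\dots,a_{p_k})$ moves head $i$ to $p_i+1$ (if $d=\mathrm{out}$) or $p_i-1$ (if $d=\mathrm{in}$) and goes to state $q'$. $M$ *accepts* $w$ if no computation on $w$ reaches $\mathrm{reject}$. Assume that no transition has target state $\mathrm{init}$, and that, on every word, whenever a computation fires a transition with target $\mathrm{accept}$ or $\mathrm{reject}$, all heads are at position $0$. **Graphings.** Let $X=\mathbf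 Z\times[0,1]^{\mathbf N}$ with $\lambda$ = counting measure times Lebesgue product measure. Weights are the pairs $(a,\epsilon)\in[0,1]\times\{0,1\}$ with product $(a,\epsilon)(b,\eta)=(ab,\max(\epsilon,\eta))$ and unit $1=(1,0)$; put $m(a,\epsilon)=a\epsilon$ and $\mathbf 1=(1,1)$. A graphing $G$ has a measurable support $V^G\subseteq X$, a finite dialect $D^G$ and a countable family of edges $e$, each with a measurable source $S_e\subseteq V^G$, control states $i_e,o_e\in D^G$, a measure-preserving map $\phi_e:X\to X$ with $\phi_e(S_e)\subseteq V^G$, and a weight $\omega_e$. An edge of $F$ (resp. $G$) goes from a pair of states in $D^F\times D^G$ to another one by changing the first (resp. second) component from $i_e$ to $o_e$. For a sequence $\pi=e_1\cdots e_l$ of edges put $\phi_\pi=\phi_{e_l}\circ\cdots\circ\phi_{e_1}$, $\omega_\pi=\prod\omega_{e_j}$, and let $S_\pi$ be the set of points on which all the edges can be followed successively. An alternating path between $F$ and $G$ is a non-empty sequence of edges alternating between $F$ and $G$, following the pairs of states, with $\lambda(S_\pi)>0$. With $C=V^F\cap V^G$, the execution $F\mathop{::}G$ has support $(V^F\cup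 V^G)\setminus C$, dialect $D^F\times D^G$, and one edge for each alternating path $\pi$, with source $S_\pi\cap C^c\cap\phi_\pi^{-1}(C^c)$, map $\phi_\pi$, weight $\omega_\pi$. The measurement is $$[\![F,G]\!]=\sum_{\pi}\int_{\operatorname{supp}\pi}\frac{m(\omega_\pi^{\rho(x)})}{\rho(x)}\,d\lambda(x),$$ over one representative $\pi$ of each class, modulo cyclic permutations, of closed alternating sequences (alternating also cyclically, and returning to their pair of states) that are not proper powers; here $\operatorname{supp}\pi$ is the set of $x$ with $\phi_\pi^j(x)\in S_\pi$ for all $j\ge0$, and $\rho(x)=\inf\{j\ge 1:\phi_\pi^j(x)=x\}$ (the integrand is $0$ if $\rho(x)=\infty$). A project of support $V$ is a pair $(a,\sum_i\alpha_iA_i)$ of a wager $a$ (a real number; for executions possibly an infinite one) and a finite formal real combination of graphings of support $V$, with $$[\![(a,\textstyle\sum_i\alpha_iA_i),(b,\sum_j\beta_jB_j)]\!]=a\sum_j\beta_j+b\sum_i\alpha_i+\sum_{i,j}\alpha_i\beta_j[\![A_i,B_j]\!],$$ and the execution of two projects is the project with this number as wager and $\sum_{i,j}\alpha_i\beta_j\,A_i\mathop{::}B_j$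 as formal sum. Two projects are orthogonal, $\perp$, if they have the same support and their measurement is neither $0$ nor infinite. A graphing $G$ is identified with $(0,G)$. **Words.** Fix an injection $\Psi:(\Sigma_\star\times\{\mathrm{in},\mathrm{out}\})\cup\{\mathtt a,\mathtt r\}\to\mathbf Z$ and write $\langle v\rangle=\{\Psi(v)\}\times[0,1]^{\mathbf N}$; here $\mathtt a,\mathtt r$ stand for accept and reject. The word graphing of $w=a_1\cdots a_n$ has support $\langle\Sigma_\star\times\{\mathrm{in},\mathrm{out}\}\rangle$, dialect $\{0,\dots,n\}$ and, for each $i$ modulo $n+1$, an edge from $\langle(a_i,\mathrm{out})\rangle$, state $i$, to $\langle(a_{i+1},\mathrm{in})\rangle$, state $i+1$, and an edge from $\langle(a_i,\mathrm{in})\rangle$, state $i$, to $\langle(a_{i-1},\mathrm{out})\rangle$, state $i-1$, realised by translations of $\mathbf Z$, with weight $1$. Fix a measure-preserving measurable bijection $[\cdot,\cdot]:[0,1]^2\to[0,1]$ with measurable inverse. For $G$ with dialect $\{0,\dots,N-1\}$, the promotion $!G$ has trivial dialect, support $\{(a,z\cdot s):(a,s)\in V^G\}$ and, for each edge $e$ of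 $G$, an edge with source $\{(a,[x,y]\cdot s):(a,s)\in S_e,\ i_e\le Nx\le i_e+1\}$, map $(a,[x,y]\cdot s)\mapsto(a',[x+(o_e-i_e)/N,\,y]\cdot s')$, where $(a',s')=\phi_e(a,s)$ and the sum is taken modulo $1$, and the weight of $e$. The set $\mathrm{Rep}(w)$ of representations of $w$ consists of all $!L$ where $L$ is obtained from the word graphing by renaming its dialect along an injection $\{0,\dots,n\}\to\{0,\dots,N-1\}$, for any $N$. **Languages.** For a set $T$ of projects (a test) and a project $P$, $$\mathcal L^T_\exists(P)=\{w:\forall t\in T\ \exists u\in\mathrm{Rep}(w),\ P\mathop{::}u\perp t\},\qquad \mathcal L^T_\forall(P)=\{w:\forall t\in T\ \forall u\in\mathrm{Rep}(w),\ P\mathop{::}u\perp t\}.$$ When both coincide they are denoted $\mathcal L^T(P)$. The test $T^-$ is $\{(\zeta,\mathrm{Id}_{\langle\mathtt r\rangle}):\zeta\in\mathbf R,\zeta\ne0\}$, where $\mathrm{Id}_{\langle\mathtt r\rangle}$ has support $\langle\mathtt a\rangle\cup\langle\mathtt r\rangle$, trivial dialect, and one edge of source $\langle\mathtt r\rangle$,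 realised by the identity, of weight $\mathbf 1$. **Encoding.** The graphing $[M]$ has support $\langle(\Sigma_\star\times\{\mathrm{in},\mathrm{out}\})\cup\{\mathtt a,\mathtt r\}\rangle$, dialect $Q\times\mathfrak S_k\times\Sigma_\star^k$, and one edge of weight $1$ for each $(t,a,d,\sigma)$ with $t=((\vec s,q),(i,d',q'))$ in $\to$ (such that $\vec s=\vec\star$ if $q=\mathrm{init}$), $a\in\Sigma_\star$, $d\in\{\mathrm{in},\mathrm{out}\}$ and $\sigma\in\mathfrak S_k$. - Its source is $\langle(s_{\sigma^{-1}(1)},d)\rangle$ in state $(q,\sigma,\vec s[\sigma^{-1}(1):=a])$ if $q\neq\mathrm{init}$. If $q=\mathrm{init}$, its source is $\langle\mathtt a\rangle$ (when $d=\mathrm{in}$) or $\langle\mathtt r\rangle$ (when $d=\mathrm{out}$), in state $(\mathrm{init},\mathrm{id},\vec\star)$. - Its target is $\langle(s_i,d')\rangle$ in state $(q',\tau_{1,\sigma(i)}\circ\sigma,\vec s)$ if $q'\notin\{\mathrm{accept},\mathrm{reject}\}$. Otherwise it is $\langle\mathtt a\rangle$ (if $q'=\mathrm{accept}$) or $\langle\mathtt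 r\rangle$ (if $q'=\mathrm{reject}$), in state $(\mathrm{init},\mathrm{id},\vec\star)$. - It is realised by the exchange of the coordinates $1$ and $\sigma(i)$ of $[0,1]^{\mathbf N}$ composed with the translation of $\mathbf Z$ from the source vertex to the target vertex. **Proposition.** For every automaton $M$ with $k$ heads as above and every word $w\in\Sigma^*$, $$w\in\mathcal L^{T^-}_\exists([M])\iff M\text{ accepts }w\iff w\in\mathcal L^{T^-}_\forall([M]).$$ In particular both languages coincide, and $w\in\mathcal L^{T^-}([M])$ if and only if $M$ accepts $w$. -/

import Mathlib

open MeasureTheory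

namespace IG

noncomputable section

/-! ### The space `ℤ × [0,1]^ℕ` -/

abbrev Seq : Type := ℕ → unitInterval

abbrev Space : Type := ℤ × Seq

def seqMeasure : Measure Seq := Measure.infinitePi fun _ => (volume : Measure unitInterval)

instance : IsProbabilityMeasure seqMeasure := by unfold seqMeasure; infer_instance

/-- Counting measure on `ℤ` times the infinite product of Lebesgue measure on `[0,1]`. -/
def spaceMeasure : Measure Space := Measure.count.prod seqMeasure

instance : SFinite spaceMeasure := by unfold spaceMeasure; infer_instance

def cons (x : unitInterval) (s : Seq) : Seq := fun n => Nat.casesOn n x s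

def tail (s : Seq) : Seq := fun n => s (n + 1)

/-- The action of a permutation of `ℕ` on sequences. -/
def permute (σ : Equiv.Perm ℕ) (s : Seq) : Seq := fun n => s (σ.symm n)

/-- `x ↦ x + l` modulo one: the fractional part of the sum. -/
def fracShift (l : ℝ) (x : unitInterval) : unitInterval :=
  ⟨Int.fract ((x : ℝ) + l), Int.fract_nonneg _, (Int.fract_lt_one _).le⟩

/-- The translation by `z` on `ℤ` together with a permutation of the copies of `[0,1]`. -/
def instr (z : ℤ) (σ : Equiv.Perm ℕ) (x : Space) : Space := (x.1 + z, permute σ x.2)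

theorem measurePreserving_permute (σ : Equiv.Perm ℕ) :
    MeasurePreserving (permute σ) seqMeasure seqMeasure where
  measurable := by unfold permute; fun_prop
  map_eq := by
    unfold seqMeasure permute
    exact Measure.map_infinitePi_infinitePi_of_inj
      (P := fun _ : ℕ => (volume : Measure unitInterval)) σ.symm.injective

theorem measurePreserving_addInt (z : ℤ) :
    MeasurePreserving (fun x : ℤ => x + z) Measure.count Measure.count where
  measurable := by fun_prop
  map_eq := by
    ext s hs
    rw [Measure.map_apply (by fun_prop) hs, ← Measure.count_injective_image
      (f := fun x : ℤ => x + z) (add_left_injective z) _,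
      Set.image_preimage_eq (f := fun x : ℤ => x + z) s (Equiv.addRight z).surjective]

theorem measurePreserving_instr (z : ℤ) (σ : Equiv.Perm ℕ) :
    MeasurePreserving (instr z σ) spaceMeasure spaceMeasure :=
  (measurePreserving_addInt z).prod (measurePreserving_permute σ)

theorem measurable_cons : Measurable fun p : unitInterval × Seq => cons p.1 p.2 := by
  refine measurable_pi_lambda _ fun n => ?_
  cases n with
  | zero => exact measurable_fst
  | succ n => exact (measurable_pi_apply n).comp measurable_snd

theorem measurable_tail : Measurable tail := by unfold tail; fun_prop

theorem measurePreserving_cons :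
    MeasurePreserving (fun p : unitInterval × Seq => cons p.1 p.2)
      ((volume : Measure unitInterval).prod seqMeasure) seqMeasure where
  measurable := measurable_cons
  map_eq := by
    refine Measure.eq_infinitePi _ fun S t ht => ?_
    have hS : Set.pi (S : Set ℕ) t = Set.pi ((Finset.range (S.sup id + 2) : Finset ℕ) : Set ℕ)
        (fun n => if n ∈ S then t n else Set.univ) := by
      ext x
      simp only [Set.mem_pi, Finset.mem_coe, Finset.mem_range]
      constructor
      · intro h n _
        split_ifs with hn
        · exact h n hn
        · trivial
      · intro h n hn
        have h' := h n (by have := Finset.le_sup (f := id) hn; simp only [id] at this; omega)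
        rwa [if_pos hn] at h'
    have hpre : (fun p : unitInterval × Seq => cons p.1 p.2) ⁻¹' (Set.pi (S : Set ℕ) t) =
        (if 0 ∈ S then t 0 else Set.univ) ×ˢ
          Set.pi ((Finset.range (S.sup id + 1) : Finset ℕ) : Set ℕ)
            (fun n => if n + 1 ∈ S then t (n + 1) else Set.univ) := by
      rw [hS]
      ext p
      simp only [Set.mem_preimage, Set.mem_pi, Set.mem_prod, Finset.mem_coe, Finset.mem_range]
      constructor
      · intro h
        exact ⟨h 0 (by omega), fun n hn => h (n + 1) (by omega)⟩
      · rintro ⟨h0, h⟩ n hn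
        cases n with
        | zero => exact h0
        | succ n => exact h n (by omega)
    have hprod : ∏ i ∈ S, (volume : Measure unitInterval) (t i) =
        ∏ i ∈ Finset.range (S.sup id + 2),
          (volume : Measure unitInterval) (if i ∈ S then t i else Set.univ) := by
      have hsub : S ⊆ Finset.range (S.sup id + 2) := fun n hn => by
        have := Finset.le_sup (f := id) hn
        simp only [id] at this
        exact Finset.mem_range.2 (by omega)
      rw [← Finset.prod_subset hsub (fun n _ hn => by simp [hn])]
      exact Finset.prod_congr rfl fun n hn => by rw [if_pos hn]
    rw [Measure.map_apply measurable_cons (MeasurableSet.pi (Finset.countable_toSet _)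
      fun n _ => ht n), hpre, Measure.prod_prod, seqMeasure, Measure.infinitePi_pi, hprod,
      Finset.prod_range_succ' _ (S.sup id + 1)]
    · rw [mul_comm]
    · intro n _
      split_ifs
      · exact ht _
      · exact MeasurableSet.univ

theorem measurePreserving_uncons :
    MeasurePreserving (fun s : Seq => (s 0, tail s)) seqMeasure
      ((volume : Measure unitInterval).prod seqMeasure) where
  measurable := (measurable_pi_apply 0).prodMk measurable_tail
  map_eq := by
    conv_lhs => rw [← measurePreserving_cons.map_eq]
    rw [Measure.map_map ((measurable_pi_apply 0).prodMk measurable_tail) measurable_cons]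
    exact Measure.map_id

theorem measurePreserving_fracShift (l : ℝ) :
    MeasurePreserving (fracShift l) (volume : Measure unitInterval) volume := by
  have hI : (volume : Measure ℝ).restrict (Set.Ioc 0 (0 + 1)) = volume.restrict unitInterval := by
    rw [zero_add]
    exact restrict_Ioc_eq_restrict_Icc
  let q : unitInterval → UnitAddCircle := fun x => ((x : ℝ) : UnitAddCircle)
  have hmk : MeasurePreserving ((↑) : ℝ → UnitAddCircle)
      ((volume : Measure ℝ).restrict unitInterval) volume := by
    rw [← hI]
    exact UnitAddCircle.measurePreserving_mk 0
  have hq : MeasurePreserving q volume volume :=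
    hmk.comp unitInterval.measurePreserving_coe
  let fr : ℝ → unitInterval := fun x => ⟨Int.fract x, Int.fract_nonneg _, (Int.fract_lt_one _).le⟩
  have hfr : Measurable fr := by fun_prop
  have hper : Function.Periodic fr 1 := fun x => Subtype.ext (by simp [fr])
  let r : UnitAddCircle → unitInterval := hper.lift
  have hr : ∀ x : ℝ, r (x : UnitAddCircle) = fr x := fun x => hper.lift_coe x
  have hrm : Measurable r := by
    intro s hs
    rw [measurableSet_quotient]
    exact hfr hs
  have hrp : MeasurePreserving r volume volume := by
    refine ⟨hrm, ?_⟩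
    rw [← hq.map_eq, Measure.map_map hrm hq.measurable]
    have hae : r ∘ q =ᵐ[volume] id := by
      have h1 : ∀ᵐ x : unitInterval, x ≠ 1 := by simp [ae_iff]
      filter_upwards [h1] with x hx
      apply Subtype.ext
      have hx1 : (x : ℝ) < 1 := lt_of_le_of_ne x.2.2 fun h => hx (Subtype.ext h)
      simp only [Function.comp, q, hr, fr, id]
      exact Int.fract_eq_self.2 ⟨x.2.1, hx1⟩
    rw [Measure.map_congr hae, Measure.map_id]
  have h := (hrp.comp (measurePreserving_add_right volume ((l : ℝ) : UnitAddCircle))).comp hq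
  have he : (r ∘ fun x => x + ((l : ℝ) : UnitAddCircle)) ∘ q = fracShift l := by
    funext x
    simp only [Function.comp, q]
    rw [← AddCircle.coe_add, hr]
    rfl
  rwa [he] at h

/-! ### Weights -/

/-- The weight `(a, ε)` in `[0,1] × {0,1}`; `true` stands for `1`. The unit is `(1, 0)` and a
product carries the mark as soon as one of its factors does. -/
@[ext] structure Weight : Type where
  val : unitInterval
  mark : Bool

instance : CommMonoid Weight where
  mul a b := ⟨a.val * b.val, a.mark || b.mark⟩
  one := ⟨1, false⟩
  mul_assoc a b c := Weight.ext (mul_assoc _ _ _) (Bool.or_assoc _ _ _)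
  one_mul a := Weight.ext (one_mul _) (Bool.false_or _)
  mul_one a := Weight.ext (mul_one _) (Bool.or_false _)
  mul_comm a b := Weight.ext (mul_comm _ _) (Bool.or_comm _ _)

/-- The parameter map `m (x, y) = x * y`. -/
def Weight.param (a : Weight) : ENNReal :=
  ENNReal.ofReal a.val * if a.mark then 1 else 0

/-! ### Graphings -/

/-- A (representative of a) weighted graphing with dialect `D`, realised by measure-preserving
self-maps of the space. -/
structure Graphing (D : Type) where
  support : Set Space
  measurableSet_support : MeasurableSet support
  Edge : Type
  countable_edge : Countable Edge
  source : Edge → Set Space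
  measurableSet_source : ∀ e, MeasurableSet (source e)
  source_subset : ∀ e, source e ⊆ support
  dialectIn : Edge → D
  dialectOut : Edge → D
  realiser : Edge → Space → Space
  measurePreserving : ∀ e, MeasurePreserving (realiser e) spaceMeasure spaceMeasure
  mapsTo : ∀ e, Set.MapsTo (realiser e) (source e) support
  weight : Edge → Weight

variable {D D' : Type}

/-- Renaming of the dialect. -/
def Graphing.rename (G : Graphing D) (f : D → D') : Graphing D' where
  support := G.support
  measurableSet_support := G.measurableSet_support
  Edge := G.Edge
  countable_edge := G.countable_edge
  source := G.source
  measurableSet_source := G.measurableSet_source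
  source_subset := G.source_subset
  dialectIn e := f (G.dialectIn e)
  dialectOut e := f (G.dialectOut e)
  realiser := G.realiser
  measurePreserving := G.measurePreserving
  mapsTo := G.mapsTo
  weight := G.weight

/-! ### Paths -/

section Paths

variable (F : Graphing D) (G : Graphing D')

abbrev JointEdge : Type := F.Edge ⊕ G.Edge

variable {F G}

def JointEdge.source : JointEdge F G → Set Space := Sum.elim F.source G.source

def JointEdge.realiser : JointEdge F G → Space → Space := Sum.elim F.realiser G.realiser

def JointEdge.weight : JointEdge F G → Weight := Sum.elim F.weight G.weight

/-- An edge of `F` (resp. `G`) acts on the first (resp. second) component of the pair of control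
states, and leaves the other one unchanged. -/
def JointEdge.Moves : JointEdge F G → D × D' → D × D' → Prop
  | Sum.inl e, p, q => p.1 = F.dialectIn e ∧ q = (F.dialectOut e, p.2)
  | Sum.inr e, p, q => p.2 = G.dialectIn e ∧ q = (p.1, G.dialectOut e)

/-- Two consecutive edges of an alternating sequence: they do not come from the same graphing. -/
def Alternate (a b : JointEdge F G) : Prop := a.isLeft ≠ b.isLeft

/-- The sequence of edges `l` leads from the pair of control states `p` to the pair `q`. -/
def Leads : List (JointEdge F G) → D × D' → D × D' → Prop
  | [], p, q => p = q
  | e :: l, p, q => ∃ r, e.Moves p r ∧ Leads l r q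

/-- The composite `φ_{e_n} ∘ ⋯ ∘ φ_{e_1}`. -/
def pathMap : List (JointEdge F G) → Space → Space
  | [], x => x
  | e :: l, x => pathMap l (e.realiser x)

/-- The points on which all edges of the sequence can be followed successively. -/
def pathDomain : List (JointEdge F G) → Set Space
  | [] => Set.univ
  | e :: l => e.source ∩ e.realiser ⁻¹' pathDomain l

def pathWeight (l : List (JointEdge F G)) : Weight := (l.map JointEdge.weight).prod

variable (F G) in
/-- An alternating path, of any non-zero length, with the pairs of control states it starts from
and leads to. -/
structure AltPath : Type where
  start : D × D'
  finish : D × D'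
  edges : List (JointEdge F G)
  ne_nil : edges ≠ []
  alternating : edges.IsChain Alternate
  leads : Leads edges start finish
  pos : 0 < spaceMeasure (pathDomain edges)

theorem JointEdge.measurableSet_source (e : JointEdge F G) : MeasurableSet e.source := by
  cases e with
  | inl e => exact F.measurableSet_source e
  | inr e => exact G.measurableSet_source e

theorem JointEdge.measurePreserving (e : JointEdge F G) :
    MeasurePreserving e.realiser spaceMeasure spaceMeasure := by
  cases e with
  | inl e => exact F.measurePreserving e
  | inr e => exact G.measurePreserving e

theorem JointEdge.source_subset (e : JointEdge F G) : e.source ⊆ F.support ∪ G.support := by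
  cases e with
  | inl e => exact (F.source_subset e).trans Set.subset_union_left
  | inr e => exact (G.source_subset e).trans Set.subset_union_right

theorem JointEdge.mapsTo (e : JointEdge F G) :
    Set.MapsTo e.realiser e.source (F.support ∪ G.support) := by
  cases e with
  | inl e => exact (F.mapsTo e).mono_right Set.subset_union_left
  | inr e => exact (G.mapsTo e).mono_right Set.subset_union_right

theorem measurePreserving_pathMap (l : List (JointEdge F G)) :
    MeasurePreserving (pathMap l) spaceMeasure spaceMeasure := by
  induction l with
  | nil => exact MeasurePreserving.id _
  | cons e l ih => exact ih.comp e.measurePreserving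

theorem measurableSet_pathDomain (l : List (JointEdge F G)) : MeasurableSet (pathDomain l) := by
  induction l with
  | nil => exact MeasurableSet.univ
  | cons e l ih => exact e.measurableSet_source.inter (e.measurePreserving.measurable ih)

theorem pathDomain_subset {l : List (JointEdge F G)} (hl : l ≠ []) :
    pathDomain l ⊆ F.support ∪ G.support := by
  cases l with
  | nil => exact absurd rfl hl
  | cons e l => exact Set.inter_subset_left.trans e.source_subset

theorem mapsTo_pathMap {l : List (JointEdge F G)} (hl : l ≠ []) :
    Set.MapsTo (pathMap l) (pathDomain l) (F.support ∪ G.support) := by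
  induction l with
  | nil => exact absurd rfl hl
  | cons e l ih =>
    rintro x ⟨hx, hx'⟩
    cases l with
    | nil => exact e.mapsTo hx
    | cons e' l => exact ih (List.cons_ne_nil _ _) hx'

/-! ### Execution -/

/-- The execution of `F` and `G`: with `C` the intersection of the supports, its edges are the
alternating paths, restricted to the points lying outside `C` and mapped outside `C`. -/
def execute (F : Graphing D) (G : Graphing D') [Finite D] [Finite D'] :
    Graphing (D × D') where
  support := (F.support ∪ G.support) \ (F.support ∩ G.support)
  measurableSet_support :=
    (F.measurableSet_support.union G.measurableSet_support).diff
      (F.measurableSet_support.inter G.measurableSet_support)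
  Edge := AltPath F G
  countable_edge := by
    have := F.countable_edge
    have := G.countable_edge
    refine Function.Injective.countable
      (f := fun p : AltPath F G => (p.start, p.finish, p.edges)) ?_
    rintro ⟨⟩ ⟨⟩ h
    simp only [Prod.mk.injEq] at h
    obtain ⟨h1, h2, h3⟩ := h
    subst h1 h2 h3
    rfl
  source p := pathDomain p.edges ∩ (F.support ∩ G.support)ᶜ ∩
    pathMap p.edges ⁻¹' (F.support ∩ G.support)ᶜ
  measurableSet_source p :=
    ((measurableSet_pathDomain _).inter
      (F.measurableSet_support.inter G.measurableSet_support).compl).inter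
      ((measurePreserving_pathMap _).measurable
        (F.measurableSet_support.inter G.measurableSet_support).compl)
  source_subset p _ hx := ⟨pathDomain_subset p.ne_nil hx.1.1, hx.1.2⟩
  dialectIn p := p.start
  dialectOut p := p.finish
  realiser p := pathMap p.edges
  measurePreserving p := measurePreserving_pathMap _
  mapsTo p _ hx := ⟨mapsTo_pathMap p.ne_nil hx.1.1, hx.2⟩
  weight p := pathWeight p.edges

/-! ### Measurement -/

/-- Alternating cycles: closed sequences of edges, alternating also between the last and the first
edge, and returning to the pair of control states they start from. No positivity is required:
a cycle that can only be followed on a null set does not contribute to the measurement. -/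
def IsAltCycle (l : List (JointEdge F G)) : Prop :=
  l ≠ [] ∧ (l : Cycle (JointEdge F G)).Chain Alternate ∧ ∃ p, Leads l p p

/-- No cyclic shift by `k ≠ 0` (modulo the length) fixes the sequence, i.e. the sequence is not a
proper power. -/
def IsPrimitive (l : List (JointEdge F G)) : Prop :=
  ∀ k, 0 < k → k < l.length → l.rotate k ≠ l

variable (F G) in
/-- A choice of one representative for each circuit, that is for each class of primitive
alternating cycles with respect to cyclic permutations. -/
def repCirc : Set (List (JointEdge F G)) :=
  {l | IsAltCycle l ∧ IsPrimitive l ∧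
    Quotient.out (s := List.IsRotated.setoid (JointEdge F G)) (l : Cycle (JointEdge F G)) = l}

/-- The points from which the cycle can be followed indefinitely. -/
def cycleSupport (l : List (JointEdge F G)) : Set Space :=
  {x | ∀ n : ℕ, (pathMap l)^[n] x ∈ pathDomain l}

/-- `m (ω ^ ρ) / ρ` where `ρ` is the least `n ≥ 1` with `φ^n x = x`, and `0` if there is none
(`Function.minimalPeriod` is `0` in that case). -/
def cycleDensity (l : List (JointEdge F G)) (x : Space) : ENNReal :=
  if Function.minimalPeriod (pathMap l) x = 0 then 0
  else (pathWeight l ^ Function.minimalPeriod (pathMap l) x).param /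
    (Function.minimalPeriod (pathMap l) x : ENNReal)

variable (F G) in
def measurement : ENNReal :=
  ∑' l : repCirc F G, ∫⁻ x in cycleSupport l.1, cycleDensity l.1 x ∂spaceMeasure

end Paths

/-! ### Projects -/

/-- A weighted term `α · A` of a formal sum of graphings. -/
structure Slice where
  coef : ℝ
  Dialect : Type
  finite_dialect : Finite Dialect
  graphing : Graphing Dialect

/-- A project `(a, ∑ αᵢ Aᵢ)`. The wager is an extended real because the wager of an execution is
a measurement, which may be infinite. -/
structure Project where
  support : Set Space
  wager : EReal
  slices : List Slice
  support_eq : ∀ s ∈ slices, s.graphing.support = support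

/-- The project `(a, G)`. -/
def Project.ofGraphing (a : EReal) [Finite D] (G : Graphing D) : Project where
  support := G.support
  wager := a
  slices := [⟨1, D, inferInstance, G⟩]
  support_eq s hs := by
    obtain rfl := List.mem_singleton.1 hs
    rfl

def Project.total (P : Project) : ℝ := (P.slices.map Slice.coef).sum

def Project.measurement (P Q : Project) : EReal :=
  P.wager * (Q.total : EReal) + Q.wager * (P.total : EReal) +
    (P.slices.map fun s => (Q.slices.map fun t =>
      ((s.coef * t.coef : ℝ) : EReal) * (IG.measurement s.graphing t.graphing : EReal)).sum).sum

def Slice.execute (s t : Slice) : Slice :=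
  haveI := s.finite_dialect
  haveI := t.finite_dialect
  { coef := s.coef * t.coef
    Dialect := s.Dialect × t.Dialect
    finite_dialect := inferInstance
    graphing := IG.execute s.graphing t.graphing }

def Project.execute (P Q : Project) : Project where
  support := (P.support ∪ Q.support) \ (P.support ∩ Q.support)
  wager := P.measurement Q
  slices := P.slices.flatMap fun s => Q.slices.map fun t => s.execute t
  support_eq r hr := by
    obtain ⟨s, hs, hr⟩ := List.mem_flatMap.1 hr
    obtain ⟨t, ht, rfl⟩ := List.mem_map.1 hr
    rw [← P.support_eq s hs, ← Q.support_eq t ht]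
    rfl

def Project.Orthogonal (P Q : Project) : Prop :=
  P.support = Q.support ∧
    P.measurement Q ≠ 0 ∧ P.measurement Q ≠ ⊤ ∧ P.measurement Q ≠ ⊥

/-! ### Representation of words -/

/-- The extended alphabet `{⋆, 0, 1}`. -/
inductive Letter : Type
  | star
  | bit (b : Bool)

inductive Dir : Type
  | inward
  | outward

inductive Vertex : Type
  | sym (a : Letter) (d : Dir)
  | acc
  | rej

instance : Finite Letter :=
  Finite.of_injective (fun a : Letter => match a with | .star => none | .bit b => some b)
    (by rintro (_ | _) (_ | _) h <;> simp_all)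

instance : Finite Dir :=
  Finite.of_injective (fun d : Dir => match d with | .inward => true | .outward => false)
    (by rintro (_ | _) (_ | _) h <;> simp_all)

def Dir.flip : Dir → Dir
  | inward => outward
  | outward => inward

/-- From a position of the circular word `⋆ a₁ ⋯ aₙ`, "out" leads to the next position and "in" to
the previous one (modulo `n + 1`). -/
def Dir.move {n : ℕ} : Dir → Fin (n + 1) → Fin (n + 1)
  | inward, p => p - 1
  | outward, p => p + 1

/-- The symbol at a position of `⋆ a₁ ⋯ aₙ`. -/
def letterAt (w : List Bool) : Fin (w.length + 1) → Letter :=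
  Fin.cases Letter.star fun i => Letter.bit (w.get i)

/-- `⟨S⟩`, for a set `S` of vertices and an injection `Ψ` of the vertices into `ℤ`. -/
def block (Ψ : Vertex ↪ ℤ) (S : Set Vertex) : Set Space := {x | x.1 ∈ Ψ '' S}

theorem measurableSet_block (Ψ : Vertex ↪ ℤ) (S : Set Vertex) : MeasurableSet (block Ψ S) :=
  measurable_fst (MeasurableSet.of_discrete (s := Ψ '' S))

theorem block_mono (Ψ : Vertex ↪ ℤ) {S T : Set Vertex} (h : S ⊆ T) : block Ψ S ⊆ block Ψ T :=
  fun _ hx => Set.image_mono h hx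

theorem mapsTo_instr (Ψ : Vertex ↪ ℤ) (u v : Vertex) (σ : Equiv.Perm ℕ) {T : Set Vertex}
    (hv : v ∈ T) : Set.MapsTo (instr (Ψ v - Ψ u) σ) (block Ψ {u}) (block Ψ T) := by
  rintro x ⟨_, rfl, hx⟩
  exact ⟨v, hv, by simp [instr, ← hx]⟩

def symbolVertices : Set Vertex := {v | ∃ a d, v = Vertex.sym a d}

/-- The word graphing. The edge `(out, i)` goes from `(aᵢ, out, i)` to `(aᵢ₊₁, in, i + 1)` and the
edge `(in, i)` goes from `(aᵢ, in, i)` to `(aᵢ₋₁, out, i - 1)`. -/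
def wordGraphing (Ψ : Vertex ↪ ℤ) (w : List Bool) : Graphing (Fin (w.length + 1)) where
  support := block Ψ symbolVertices
  measurableSet_support := measurableSet_block _ _
  Edge := Dir × Fin (w.length + 1)
  countable_edge := inferInstance
  source e := block Ψ {Vertex.sym (letterAt w e.2) e.1}
  measurableSet_source _ := measurableSet_block _ _
  source_subset _ := block_mono Ψ (Set.singleton_subset_iff.2 ⟨_, _, rfl⟩)
  dialectIn e := e.2
  dialectOut e := e.1.move e.2
  realiser e := instr (Ψ (Vertex.sym (letterAt w (e.1.move e.2)) e.1.flip) -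
    Ψ (Vertex.sym (letterAt w e.2) e.1)) 1
  measurePreserving _ := measurePreserving_instr _ _
  mapsTo _ := mapsTo_instr Ψ _ _ _ ⟨_, _, rfl⟩
  weight _ := 1

/-! ### Promotion -/

section Promotion

variable (pair : unitInterval × unitInterval ≃ᵐ unitInterval)

/-- `(a, [x, y] · s) ↦ (a', [x + l, y] · s')` where `(a', s') = φ (a, s)`; the sum `x + l` is taken
modulo one. -/
def promoteMap (l : ℝ) (φ : Space → Space) (x : Space) : Space :=
  ((φ (x.1, tail x.2)).1,
    cons (pair (fracShift l (pair.symm (x.2 0)).1, (pair.symm (x.2 0)).2))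
      (φ (x.1, tail x.2)).2)

/-- The points `(a, [x, y] · s)` with `(a, s) ∈ A` and `i ≤ N x ≤ i + 1`. -/
def promoteSet (N i : ℕ) (A : Set Space) : Set Space :=
  {x | (x.1, tail x.2) ∈ A ∧
    (i : ℝ) ≤ N * ((pair.symm (x.2 0)).1 : ℝ) ∧ N * ((pair.symm (x.2 0)).1 : ℝ) ≤ i + 1}

theorem measurable_dropHead : Measurable fun x : Space => ((x.1, tail x.2) : Space) :=
  measurable_fst.prodMk (measurable_tail.comp measurable_snd)

theorem measurableSet_promoteSet (N i : ℕ) {A : Set Space} (hA : MeasurableSet A) :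
    MeasurableSet (promoteSet pair N i A) := by
  have h : Measurable fun x : Space => (N : ℝ) * ((pair.symm (x.2 0)).1 : ℝ) := by fun_prop
  exact (measurable_dropHead hA).inter
    ((measurableSet_le measurable_const h).inter (measurableSet_le h measurable_const))

variable {pair}

theorem measurePreserving_promoteMap (hpair : MeasurePreserving pair) (l : ℝ)
    {φ : Space → Space} (hφ : MeasurePreserving φ spaceMeasure spaceMeasure) :
    MeasurePreserving (promoteMap pair l φ) spaceMeasure spaceMeasure := by
  have hsymm : MeasurePreserving pair.symm volume volume := hpair.symm pair
  have hhead : MeasurePreserving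
      (fun z => pair (fracShift l (pair.symm z).1, (pair.symm z).2)) volume volume :=
    (hpair.comp ((measurePreserving_fracShift l).prod (MeasurePreserving.id _))).comp hsymm
  have h1 : MeasurePreserving (fun x : Space => (x.2 0, ((x.1, tail x.2) : Space))) spaceMeasure
      ((volume : Measure unitInterval).prod spaceMeasure) :=
    ((measurePreserving_prodAssoc volume Measure.count seqMeasure).comp
      (Measure.measurePreserving_swap.prod (MeasurePreserving.id seqMeasure))).comp
      (((measurePreserving_prodAssoc Measure.count volume seqMeasure).symm _).comp
        ((MeasurePreserving.id (Measure.count (α := ℤ))).prod measurePreserving_uncons))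
  have h2 : MeasurePreserving (fun p : unitInterval × Space => ((p.2.1, cons p.1 p.2.2) : Space))
      ((volume : Measure unitInterval).prod spaceMeasure) spaceMeasure :=
    ((MeasurePreserving.id (Measure.count (α := ℤ))).prod measurePreserving_cons).comp
      ((measurePreserving_prodAssoc Measure.count volume seqMeasure).comp
        ((Measure.measurePreserving_swap.prod (MeasurePreserving.id seqMeasure)).comp
          ((measurePreserving_prodAssoc volume Measure.count seqMeasure).symm _)))
  exact (h2.comp (hhead.prod hφ)).comp h1

/-- The promotion of a graphing whose dialect has `N` elements. -/
def promote (hpair : MeasurePreserving pair) {N : ℕ} (G : Graphing (Fin N)) : Graphing Unit where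
  support := {x | (x.1, tail x.2) ∈ G.support}
  measurableSet_support := measurable_dropHead G.measurableSet_support
  Edge := G.Edge
  countable_edge := G.countable_edge
  source e := promoteSet pair N (G.dialectIn e) (G.source e)
  measurableSet_source e := measurableSet_promoteSet pair _ _ (G.measurableSet_source e)
  source_subset e _ hx := G.source_subset e hx.1
  dialectIn _ := ()
  dialectOut _ := ()
  realiser e := promoteMap pair
    ((((G.dialectOut e : ℕ) : ℝ) - ((G.dialectIn e : ℕ) : ℝ)) / N) (G.realiser e)
  measurePreserving e := measurePreserving_promoteMap hpair _ (G.measurePreserving e)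
  mapsTo _ _ hx := G.mapsTo _ hx.1
  weight := G.weight

/-- The representations of the word `w`: the promotions of the graphings obtained from the word
graphing by an injective renaming of the dialect. -/
def representations (Ψ : Vertex ↪ ℤ) (hpair : MeasurePreserving pair) (w : List Bool) :
    Set Project :=
  {P | ∃ (N : ℕ) (f : Fin (w.length + 1) ↪ Fin N),
    P = Project.ofGraphing 0 (promote hpair ((wordGraphing Ψ w).rename f))}

/-! ### Tests and languages -/

def existsLanguage (Ψ : Vertex ↪ ℤ) (hpair : MeasurePreserving pair) (T : Set Project)
    (M : Project) : Set (List Bool) :=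
  {w | ∀ t ∈ T, ∃ P ∈ representations Ψ hpair w, (M.execute P).Orthogonal t}

def forallLanguage (Ψ : Vertex ↪ ℤ) (hpair : MeasurePreserving pair) (T : Set Project)
    (M : Project) : Set (List Bool) :=
  {w | ∀ t ∈ T, ∀ P ∈ representations Ψ hpair w, (M.execute P).Orthogonal t}

end Promotion

/-- The identity of `⟨r⟩` with weight `1 · 𝟏`, of support `⟨a⟩ ∪ ⟨r⟩`. -/
def rejectIdentity (Ψ : Vertex ↪ ℤ) : Graphing Unit where
  support := block Ψ {Vertex.acc, Vertex.rej}
  measurableSet_support := measurableSet_block _ _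
  Edge := Unit
  countable_edge := inferInstance
  source _ := block Ψ {Vertex.rej}
  measurableSet_source _ := measurableSet_block _ _
  source_subset _ := block_mono Ψ (by simp)
  dialectIn _ := ()
  dialectOut _ := ()
  realiser _ := id
  measurePreserving _ := MeasurePreserving.id _
  mapsTo _ := block_mono Ψ (by simp)
  weight _ := ⟨1, true⟩

/-- The test `T⁻ = {(ζ, Id_⟨r⟩) | ζ ≠ 0}`. -/
def negTest (Ψ : Vertex ↪ ℤ) : Set Project :=
  {P | ∃ ζ : ℝ, ζ ≠ 0 ∧ P = Project.ofGraphing (ζ : EReal) (rejectIdentity Ψ)}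

/-! ### Multihead automata -/

/-- Nondeterministic two-way automata with `k` heads; a transition is a pair
`((s, q), ((i, d), q'))`. -/
structure Automaton (k : ℕ) where
  State : Type
  finite_state : Finite State
  init : State
  accept : State
  reject : State
  init_ne_accept : init ≠ accept
  init_ne_reject : init ≠ reject
  accept_ne_reject : accept ≠ reject
  trans : Set (((Fin k → Letter) × State) × ((Fin k × Dir) × State))

namespace Automaton

variable {k : ℕ} (M : Automaton k)

/-- The positions of the heads on `⋆ a₁ ⋯ aₙ`, and the state. -/
abbrev Config (w : List Bool) : Type := (Fin k → Fin (w.length + 1)) × M.State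

def initial (w : List Bool) : M.Config w := (fun _ => 0, M.init)

/-- One step: exactly one head moves. The computation stops in the states `accept`, `reject`. -/
def Step (w : List Bool) (c c' : M.Config w) : Prop :=
  c.2 ≠ M.accept ∧ c.2 ≠ M.reject ∧ ∃ i d,
    ((fun j => letterAt w (c.1 j), c.2), ((i, d), c'.2)) ∈ M.trans ∧
      c'.1 = Function.update c.1 i (d.move (c.1 i))

def Reachable (w : List Bool) (c : M.Config w) : Prop :=
  Relation.ReflTransGen (M.Step w) (M.initial w) c

/-- No computation trace on `w` leads to the rejecting state. -/
def Accepts (w : List Bool) : Prop := ¬ ∃ c : M.Config w, M.Reachable w c ∧ c.2 = M.reject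

/-- The initial state is never entered again. -/
def NeverReturnsToInit : Prop := ∀ t ∈ M.trans, t.2.2 ≠ M.init

/-- All heads are on the left end-marker whenever a computation fires a transition to the accepting
or to the rejecting state. -/
def RepositionsHeads : Prop :=
  ∀ (w : List Bool) (c c' : M.Config w), M.Reachable w c → M.Step w c c' →
    (c'.2 = M.accept ∨ c'.2 = M.reject) → ∀ j, c.1 j = 0

/-! ### Automata as machines -/

/-- The control states of the encoding: a state of the automaton, the permutation `σ` mapping each
head to the coordinate it currently uses, and one stored symbol per head. -/
abbrev Dialect : Type := M.State × Equiv.Perm (Fin k) × (Fin k → Letter)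

/-- The edges `([t], a, d, σ)`. A transition out of the initial state is encoded only if it reads
`⋆` under all heads, the others being never fired. -/
abbrev EncEdge : Type :=
  {t : ((Fin k → Letter) × M.State) × ((Fin k × Dir) × M.State) //
    t ∈ M.trans ∧ (t.1.2 = M.init → t.1.1 = fun _ => Letter.star)} ×
  Letter × Dir × Equiv.Perm (Fin k)

def homeDialect : M.Dialect := (M.init, 1, fun _ => Letter.star)

variable [NeZero k]

open Classical in
/-- The edge reads `s (σ⁻¹ 1)`, the symbol that the head moved last has just discovered; an edge out
of the initial state starts from `⟨a⟩` or from `⟨r⟩`. -/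
def sourceVertex : M.EncEdge → Vertex
  | (⟨((s, q), _), _⟩, _, d, σ) =>
    if q = M.init then
      match d with
      | Dir.inward => Vertex.acc
      | Dir.outward => Vertex.rej
    else Vertex.sym (s (σ.symm 0)) d

open Classical in
/-- The stored symbols are those read by the transition, except for the head moved last: its stored
symbol `a` is the outdated one. -/
def sourceDialect : M.EncEdge → M.Dialect
  | (⟨((s, q), _), _⟩, a, _, σ) =>
    if q = M.init then M.homeDialect else (q, σ, Function.update s (σ.symm 0) a)

open Classical in
def targetVertex : M.EncEdge → Vertex
  | (⟨((s, _), ((i, d'), q')), _⟩, _, _, _) =>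
    if q' = M.accept then Vertex.acc
    else if q' = M.reject then Vertex.rej
    else Vertex.sym (s i) d'

open Classical in
def targetDialect : M.EncEdge → M.Dialect
  | (⟨((s, _), ((i, _), q')), _⟩, _, _, σ) =>
    if q' = M.accept ∨ q' = M.reject then M.homeDialect
    else (q', Equiv.swap 0 (σ i) * σ, s)

/-- The transposition `(1, σ i)`, acting on the copies of `[0,1]` (which are numbered from `0`). -/
def headSwap : M.EncEdge → Equiv.Perm ℕ
  | (⟨(_, ((i, _), _)), _⟩, _, _, σ) => Equiv.swap 0 (σ i : ℕ)

/-- The graphing `[M]`. -/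
def encode (Ψ : Vertex ↪ ℤ) : Graphing M.Dialect where
  support := block Ψ Set.univ
  measurableSet_support := measurableSet_block _ _
  Edge := M.EncEdge
  countable_edge := by
    have := M.finite_state
    infer_instance
  source e := block Ψ {M.sourceVertex e}
  measurableSet_source _ := measurableSet_block _ _
  source_subset _ := block_mono Ψ (Set.subset_univ _)
  dialectIn := M.sourceDialect
  dialectOut := M.targetDialect
  realiser e := instr (Ψ (M.targetVertex e) - Ψ (M.sourceVertex e)) (M.headSwap e)
  measurePreserving _ := measurePreserving_instr _ _
  mapsTo _ := mapsTo_instr Ψ _ _ _ (Set.mem_univ _)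
  weight _ := 1

/-- The project `(0, [M])`. -/
def machine (Ψ : Vertex ↪ ℤ) : Project :=
  haveI := M.finite_state
  Project.ofGraphing 0 (M.encode Ψ)

end Automaton

end

end IG

/-! No weight of `[M]` or of a word is marked, so the wager of `[M] :: u` is `0`, and its
measurement against `(ζ, Id_⟨r⟩)` is `ζ + μ`, where `μ` is the measurement of the executed graphing
against `Id_⟨r⟩`. The point is that `μ` is `0` if `M` accepts `w` and `∞` otherwise, for every
representation (`measurement_eq_zero_of_accepts`, `measurement_eq_top_of_not_accepts`). As `ζ` is
real and nonzero, `ζ + μ` is nonzero and finite exactly when `M` accepts.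

Points encode head positions. Promotion cuts `[0,1]` into `N` cells, and head `j` is at position `p`
when the coordinate `σ j` lies in the cell `f p`. A word edge acts on coordinate `0` only, rotating
it from the cell of a position to that of a neighbour; an edge of `[M]` brings the coordinate of the
head to be moved into place `0`, while the dialect records the state, `σ` and the letters read.
Alternating paths thus simulate computations.

Accepting case. A circuit contributing to `μ` would contain, between two passages through `Id_⟨r⟩`,
an alternating path from `⟨r⟩` to `⟨r⟩`. Away from the null set of points with a coordinate on a
cell boundary, such a path yields a rejecting computation (`exists_reachable_reject`). Hence every
cycle has null support.

Rejecting case. A rejecting computation is followed by a path on the whole box of points over `⟨r⟩`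
whose first `k` coordinates lie in the cell of position `0` (`exists_path_of_reachable`). The heads
are back at `0` when the rejecting transition is fired, so the displacements cancel and the path
acts on the box by a permutation of coordinates, of some finite order `m`. An edge leaving `init`
ignores its letter, so the path has distinct copies `A`, `B` with the same action. With `I` the edge
of `Id_⟨r⟩`, the circuits `A I (B I)ⁿ` are primitive and pairwise distinct, and each contributes at
least `1/m` times the measure of the box (`measurement_eq_top`). -/

namespace IG

/-! ### Paths and circuits -/

section PathLemmas

variable {D D' : Type} {F : Graphing D} {G : Graphing D'}

theorem pathMap_append (l₁ l₂ : List (JointEdge F G)) (x : Space) :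
    pathMap (l₁ ++ l₂) x = pathMap l₂ (pathMap l₁ x) := by
  induction l₁ generalizing x with
  | nil => rfl
  | cons e l ih => exact ih _

theorem mem_pathDomain_append {l₁ l₂ : List (JointEdge F G)} {x : Space} :
    x ∈ pathDomain (l₁ ++ l₂) ↔ x ∈ pathDomain l₁ ∧ pathMap l₁ x ∈ pathDomain l₂ := by
  induction l₁ generalizing x with
  | nil => simp [pathDomain, pathMap]
  | cons e l ih => simp [pathDomain, pathMap, ih, and_assoc]

theorem Leads.append {l₁ l₂ : List (JointEdge F G)} {p q r : D × D'} (h₁ : Leads l₁ p q)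
    (h₂ : Leads l₂ q r) : Leads (l₁ ++ l₂) p r := by
  induction l₁ generalizing p with
  | nil => obtain rfl := h₁; exact h₂
  | cons e l ih =>
    obtain ⟨s, hs, h⟩ := h₁
    exact ⟨s, hs, ih h⟩

theorem Leads.of_moves {l : List (JointEdge F G)} {p : D × D'} (h : ∀ e ∈ l, e.Moves p p) :
    Leads l p p := by
  induction l with
  | nil => rfl
  | cons e l ih =>
    exact ⟨p, h e List.mem_cons_self, ih fun e' he' => h e' (List.mem_cons_of_mem _ he')⟩

theorem pathWeight_eq_one {l : List (JointEdge F G)} (h : ∀ e ∈ l, e.weight = 1) :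
    pathWeight l = 1 :=
  List.prod_eq_one fun _ hw => by
    obtain ⟨e, he, rfl⟩ := List.mem_map.1 hw
    exact h e he

/-- The unit is unmarked and `param` only sees marked weights, so only cycles meeting a marked edge
can be measured. -/
theorem Weight.param_one : Weight.param 1 = 0 := by
  change ENNReal.ofReal _ * (if false then 1 else 0) = 0
  simp

/-- Graphings without marked weights have measurement `0`. -/
theorem measurement_eq_zero_of_weight (hF : ∀ e, F.weight e = 1) (hG : ∀ e, G.weight e = 1) :
    measurement F G = 0 := by
  refine ENNReal.tsum_eq_zero.2 fun l => ?_
  have h : pathWeight l.1 = 1 := pathWeight_eq_one fun e _ => by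
    cases e
    · exact hF _
    · exact hG _
  simp [cycleDensity, h, Weight.param_one]

theorem measurement_eq_zero_of_null
    (h : ∀ l : List (JointEdge F G), IsAltCycle l → spaceMeasure (cycleSupport l) = 0) :
    measurement F G = 0 :=
  ENNReal.tsum_eq_zero.2 fun l => setLIntegral_measure_zero _ _ (h l.1 l.2.1)

/-- The letter `a` occurs only once, so a rotation by less than the length that is not trivial
brings an element of `l'` to the front in its place. -/
theorem isPrimitive_of_isRotated {a : JointEdge F G} {l l' : List (JointEdge F G)} (ha : a ∉ l')
    (h : l ~r (a :: l')) : IsPrimitive l := by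
  intro k hk hkl hr
  obtain ⟨m, rfl⟩ := h.symm
  rw [List.rotate_rotate, Nat.add_comm, ← List.rotate_rotate] at hr
  have hr' := List.rotate_injective m hr
  rw [List.length_rotate] at hkl
  rw [List.rotate_eq_drop_append_take hkl.le] at hr'
  obtain ⟨k, rfl⟩ := Nat.exists_eq_succ_of_ne_zero hk.ne'
  rw [List.length_cons, Nat.succ_eq_add_one, Nat.add_lt_add_iff_right] at hkl
  rw [Nat.succ_eq_add_one, List.drop_succ_cons, List.drop_eq_getElem_cons hkl, List.cons_append,
    List.cons.injEq] at hr'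
  exact ha (hr'.1 ▸ List.getElem_mem hkl)

/-- Weight-one edges `A ≠ B` of `F` and an edge `I` of `G` of weight `𝟏`, acting on a set `E` of
positive measure in the same periodic way and trivially respectively, force an infinite
measurement. -/
theorem measurement_eq_top {A B : F.Edge} (hAB : A ≠ B) {I : G.Edge} {p : D × D'}
    (hA : JointEdge.Moves (F := F) (G := G) (Sum.inl A) p p)
    (hB : JointEdge.Moves (F := F) (G := G) (Sum.inl B) p p)
    (hI : JointEdge.Moves (F := F) (G := G) (Sum.inr I) p p)
    (hAw : F.weight A = 1) (hBw : F.weight B = 1) (hIw : G.weight I = ⟨1, true⟩)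
    {E : Set Space} (hE : MeasurableSet E) (hE0 : spaceMeasure E ≠ 0)
    {ψ : Space → Space} (hψ : Set.MapsTo ψ E E) {m : ℕ} (hm : 0 < m)
    (hψm : ∀ x ∈ E, ψ^[m] x = x)
    (hAE : ∀ x ∈ E, x ∈ F.source A ∧ F.realiser A x = ψ x)
    (hBE : ∀ x ∈ E, x ∈ F.source B ∧ F.realiser B x = ψ x)
    (hIE : ∀ x ∈ E, x ∈ G.source I ∧ G.realiser I x = x) :
    measurement F G = ⊤ := by
  classical
  let S : Set (JointEdge F G) := {Sum.inl A, Sum.inl B, Sum.inr I}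
  -- The exponent `c` counts the edges `A` and `B` of `l`; the edge `I` fixes `E` pointwise.
  have hpath : ∀ l : List (JointEdge F G), (∀ e ∈ l, e ∈ S) →
      ∃ c, ∀ x ∈ E, x ∈ pathDomain l ∧ pathMap l x = ψ^[c] x := by
    intro l hl
    induction l with
    | nil => exact ⟨0, fun x _ => ⟨trivial, rfl⟩⟩
    | cons e l ih =>
      obtain ⟨c, hc⟩ := ih fun e' he' => hl e' (List.mem_cons_of_mem _ he')
      rcases hl e List.mem_cons_self with rfl | rfl | rfl
      · refine ⟨c + 1, fun x hx => ?_⟩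
        have h := hc (ψ x) (hψ hx)
        have h' := hAE x hx
        refine ⟨⟨h'.1, ?_⟩, ?_⟩
        · change pathDomain l (F.realiser A x)
          rw [h'.2]
          exact h.1
        · change pathMap l (F.realiser A x) = _
          rw [h'.2, h.2]
          rfl
      · refine ⟨c + 1, fun x hx => ?_⟩
        have h := hc (ψ x) (hψ hx)
        have h' := hBE x hx
        refine ⟨⟨h'.1, ?_⟩, ?_⟩
        · change pathDomain l (F.realiser B x)
          rw [h'.2]
          exact h.1
        · change pathMap l (F.realiser B x) = _
          rw [h'.2, h.2]
          rfl
      · refine ⟨c, fun x hx => ?_⟩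
        have h := hc x hx
        have h' := hIE x hx
        refine ⟨⟨h'.1, ?_⟩, ?_⟩
        · change pathDomain l (G.realiser I x)
          rw [h'.2]
          exact h.1
        · change pathMap l (G.realiser I x) = _
          rw [h'.2, h.2]
  -- Since `𝟏` is idempotent, one passage through `I` gives a sequence, and all its positive powers,
  -- the weight `𝟏`.
  have hidem : (⟨1, true⟩ : Weight) * ⟨1, true⟩ = ⟨1, true⟩ := Weight.ext (mul_one _) rfl
  have hweight : ∀ l : List (JointEdge F G), (∀ e ∈ l, e ∈ S) → Sum.inr I ∈ l →
      pathWeight l = ⟨1, true⟩ := by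
    intro l hl hIl
    have hor : ∀ l : List (JointEdge F G), (∀ e ∈ l, e ∈ S) →
        pathWeight l = 1 ∨ pathWeight l = ⟨1, true⟩ := by
      intro l hl
      induction l with
      | nil => exact Or.inl rfl
      | cons e l ih =>
        have ih' := ih fun e' he' => hl e' (List.mem_cons_of_mem _ he')
        have hcons : pathWeight (e :: l) = e.weight * pathWeight l := by simp [pathWeight]
        rw [hcons]
        rcases hl e List.mem_cons_self with rfl | rfl | rfl
        · simpa [JointEdge.weight, hAw] using ih'
        · simpa [JointEdge.weight, hBw] using ih'
        · refine Or.inr ?_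
          rcases ih' with h | h <;> simp [JointEdge.weight, hIw, h, hidem]
    obtain ⟨l₁, l₂, rfl⟩ := List.append_of_mem hIl
    have hprod : pathWeight (l₁ ++ Sum.inr I :: l₂) =
        pathWeight l₁ * (⟨1, true⟩ * pathWeight l₂) := by
      simp [pathWeight, JointEdge.weight, hIw]
    rw [hprod]
    rcases hor l₁ fun e he => hl e (by simp [he]) with h₁ | h₁ <;>
    rcases hor l₂ fun e he => hl e (by simp [he]) with h₂ | h₂ <;>
    simp [h₁, h₂, hidem]
  -- On `E` the cycle acts as a power of `ψ`, so its period `ρ` is at most `m` and its density `1/ρ`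
  -- at least `1/m`.
  have hbound : ∀ l : List (JointEdge F G), (∀ e ∈ l, e ∈ S) → Sum.inr I ∈ l →
      (m : ENNReal)⁻¹ * spaceMeasure E ≤
        ∫⁻ x in cycleSupport l, cycleDensity l x ∂spaceMeasure := by
    intro l hl hIl
    obtain ⟨c, hc⟩ := hpath l hl
    have hmaps : Set.MapsTo (pathMap l) E E := fun x hx => by
      rw [(hc x hx).2]
      exact hψ.iterate c hx
    have hiter : ∀ n, ∀ x ∈ E, (pathMap l)^[n] x = ψ^[c * n] x := by
      intro n
      induction n with
      | zero => intro x _; rfl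
      | succ n ih =>
        intro x hx
        rw [Function.iterate_succ_apply, ih _ (hmaps hx), (hc x hx).2,
          ← Function.iterate_add_apply]
        rfl
    have hsub : E ⊆ cycleSupport l := fun x hx n => (hc _ (hmaps.iterate n hx)).1
    have hper : ∀ x ∈ E, Function.IsPeriodicPt (pathMap l) m x := by
      intro x hx
      have h : Function.IsPeriodicPt ψ m x := hψm x hx
      change (pathMap l)^[m] x = x
      rw [hiter m x hx]
      exact h.const_mul c
    calc (m : ENNReal)⁻¹ * spaceMeasure E = ∫⁻ _ in E, (m : ENNReal)⁻¹ ∂spaceMeasure := by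
          rw [setLIntegral_const]
      _ ≤ ∫⁻ x in E, cycleDensity l x ∂spaceMeasure := by
          refine setLIntegral_mono' hE fun x hx => ?_
          have hpos := (hper x hx).minimalPeriod_pos hm
          have hle := (hper x hx).minimalPeriod_le hm
          obtain ⟨r, hr⟩ := Nat.exists_eq_succ_of_ne_zero hpos.ne'
          rw [cycleDensity, if_neg hpos.ne', hweight l hl hIl]
          have hpow : (⟨1, true⟩ : Weight) ^ Function.minimalPeriod (pathMap l) x = ⟨1, true⟩ := by
            rw [hr]
            exact IsIdempotentElem.pow_succ_eq r hidem
          rw [hpow]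
          simp only [Weight.param, Set.Icc.coe_one, ENNReal.ofReal_one, if_true, one_mul,
            one_div]
          exact ENNReal.inv_le_inv.2 (by exact_mod_cast hle)
      _ ≤ _ := lintegral_mono_set hsub
  -- Preceded by `A`, this is the circuit `A I (B I)ⁿ`. The single occurrence of `A ≠ B` makes it
  -- primitive; with `A` alone every such sequence would be a power of `A I`.
  let tl : ℕ → List (JointEdge F G) := fun n =>
    Sum.inr I :: (List.replicate n [Sum.inl B, Sum.inr I]).flatten
  have htl : ∀ n, ∀ e ∈ tl n, e = Sum.inl B ∨ e = Sum.inr I := by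
    intro n e he
    rcases List.mem_cons.1 he with rfl | he
    · exact Or.inr rfl
    · obtain ⟨l, hl, he⟩ := List.mem_flatten.1 he
      rw [List.eq_of_mem_replicate hl] at he
      simpa using he
  have hchain : ∀ n, List.IsChain Alternate (tl n ++ [Sum.inl A]) := by
    intro n
    induction n with
    | zero => simp [tl, Alternate]
    | succ n ih =>
      have : tl (n + 1) ++ [Sum.inl A] = Sum.inr I :: Sum.inl B :: (tl n ++ [Sum.inl A]) := by
        simp [tl, List.replicate_succ]
      rw [this]
      refine List.isChain_cons_cons.2 ⟨by simp [Alternate], ?_⟩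
      have h2 : tl n ++ [Sum.inl A] = Sum.inr I ::
          ((List.replicate n [Sum.inl B, Sum.inr I]).flatten ++ [Sum.inl A]) := rfl
      rw [h2] at ih ⊢
      exact List.isChain_cons_cons.2 ⟨by simp [Alternate], ih⟩
  have hlen : ∀ n, (tl n).length = 2 * n + 1 := by
    intro n
    simp [tl]
    ring
  let cyc : ℕ → Cycle (JointEdge F G) := fun n => ((Sum.inl A :: tl n : List _) : Cycle _)
  let rep : ℕ → List (JointEdge F G) := fun n =>
    Quotient.out (s := List.IsRotated.setoid (JointEdge F G)) (cyc n)
  have hrep : ∀ n, ((rep n : List _) : Cycle (JointEdge F G)) = cyc n := fun n =>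
    Quotient.out_eq (s := List.IsRotated.setoid (JointEdge F G)) (cyc n)
  have hrot : ∀ n, rep n ~r (Sum.inl A :: tl n) := fun n => Cycle.coe_eq_coe.1 (hrep n)
  have hS : ∀ n, ∀ e ∈ rep n, e ∈ S := by
    intro n e he
    rcases List.mem_cons.1 ((hrot n).mem_iff.1 he) with h | h
    · exact Or.inl h
    · exact Or.inr (htl n e h)
  have hmem : ∀ n, rep n ∈ repCirc F G := by
    refine fun n => ⟨⟨?_, ?_, p, Leads.of_moves fun e he => ?_⟩,
      isPrimitive_of_isRotated (fun h => ?_) (hrot n), ?_⟩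
    · intro h
      have := (hrot n).perm.length_eq
      simp [h] at this
    · rw [hrep]
      refine (Cycle.chain_coe_cons _ _ _).2 ?_
      have h2 : tl n ++ [Sum.inl A] = Sum.inr I ::
          ((List.replicate n [Sum.inl B, Sum.inr I]).flatten ++ [Sum.inl A]) := rfl
      have h3 := hchain n
      rw [h2] at h3 ⊢
      exact List.isChain_cons_cons.2 ⟨by simp [Alternate], h3⟩
    · rcases hS n e he with rfl | rfl | rfl
      · exact hA
      · exact hB
      · exact hI
    · rcases htl n _ h with h | h
      · exact hAB (Sum.inl_injective h)
      · exact absurd h Sum.inl_ne_inr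
    · rw [hrep]
  -- The circuits have length `2n + 2`, which rotation to the chosen representative preserves.
  have hinj : Function.Injective fun n => (⟨rep n, hmem n⟩ : repCirc F G) := by
    intro a b hab
    have h1 := (hrot a).perm.length_eq
    have h2 := (hrot b).perm.length_eq
    have hab' : rep a = rep b := congrArg Subtype.val hab
    rw [List.length_cons, hlen] at h1 h2
    rw [hab'] at h1
    omega
  refine top_le_iff.1 ?_
  calc (⊤ : ENNReal) = ∑' _ : ℕ, (m : ENNReal)⁻¹ * spaceMeasure E :=
        (ENNReal.tsum_const_eq_top_of_ne_zero
          (mul_ne_zero (ENNReal.inv_ne_zero.2 (ENNReal.natCast_ne_top m)) hE0)).symm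
    _ ≤ ∑' n : ℕ, ∫⁻ x in cycleSupport (rep n), cycleDensity (rep n) x ∂spaceMeasure :=
        ENNReal.tsum_le_tsum fun n => hbound _ (hS n)
          ((hrot n).mem_iff.2 (List.mem_cons_of_mem _ List.mem_cons_self))
    _ ≤ measurement F G := ENNReal.tsum_comp_le_tsum_of_injective hinj
        fun l : repCirc F G => ∫⁻ x in cycleSupport l.1, cycleDensity l.1 x ∂spaceMeasure

end PathLemmas

/-! ### Permutations and shifts of the coordinates -/

theorem permute_one (s : Seq) : permute 1 s = s := rfl

theorem permute_permute (σ τ : Equiv.Perm ℕ) (s : Seq) :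
    permute σ (permute τ s) = permute (σ * τ) s := rfl

theorem permute_swap_apply {k : ℕ} (a b c : Fin k) (s : Seq) :
    permute (Equiv.swap (a : ℕ) b) s (Equiv.swap a b c : Fin k) = s c := by
  simp only [permute, Equiv.symm_swap]
  rw [← Fin.val_injective.swap_apply, Equiv.swap_apply_self]

theorem permute_swap_zero_apply {k : ℕ} [NeZero k] (b c : Fin k) (s : Seq) :
    permute (Equiv.swap 0 (b : ℕ)) s (Equiv.swap 0 b c : Fin k) = s c := by
  simpa using permute_swap_apply 0 b c s

/-- A permutation of `Fin k`, extended to `ℕ` by the identity. -/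
def extendPerm {k : ℕ} (σ : Equiv.Perm (Fin k)) : Equiv.Perm ℕ :=
  σ.extendDomain Fin.equivSubtype

theorem extendPerm_apply {k : ℕ} (σ : Equiv.Perm (Fin k)) (j : Fin k) :
    extendPerm σ j = σ j :=
  Equiv.Perm.extendDomain_apply_image σ Fin.equivSubtype j

theorem extendPerm_symm_apply {k : ℕ} (σ : Equiv.Perm (Fin k)) (j : Fin k) :
    (extendPerm σ).symm j = σ.symm j := by
  rw [Equiv.symm_apply_eq, extendPerm_apply, Equiv.apply_symm_apply]

theorem extendPerm_apply_of_le {k n : ℕ} (σ : Equiv.Perm (Fin k)) (h : k ≤ n) :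
    extendPerm σ n = n :=
  Equiv.Perm.extendDomain_apply_not_subtype σ Fin.equivSubtype (not_lt.2 h)

theorem extendPerm_mul {k : ℕ} (σ τ : Equiv.Perm (Fin k)) :
    extendPerm (σ * τ) = extendPerm σ * extendPerm τ :=
  (Equiv.Perm.extendDomain_mul _ σ τ).symm

theorem extendPerm_one {k : ℕ} : extendPerm (1 : Equiv.Perm (Fin k)) = 1 :=
  Equiv.Perm.extendDomain_one _

theorem extendPerm_swap {k : ℕ} (a b : Fin k) :
    extendPerm (Equiv.swap a b) = Equiv.swap (a : ℕ) b := by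
  ext n
  by_cases h : n < k
  · have h1 := extendPerm_apply (Equiv.swap a b) ⟨n, h⟩
    have h2 := Fin.val_injective.swap_apply a b ⟨n, h⟩
    exact h1.trans h2.symm
  · rw [extendPerm_apply_of_le _ (not_lt.1 h), Equiv.swap_apply_of_ne_of_ne] <;> omega

/-! ### Cells of a promotion and rotations between them -/

section Shift

variable (pair : unitInterval × unitInterval ≃ᵐ unitInterval)

/-- The first component of a point of `[0,1]` seen as a pair. -/
def coord (u : unitInterval) : ℝ := (pair.symm u).1

/-- The rotation of the first component of a point of `[0,1]` seen as a pair. -/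
noncomputable def shift (l : ℝ) (u : unitInterval) : unitInterval :=
  pair (fracShift l (pair.symm u).1, (pair.symm u).2)

variable {pair}

theorem coord_shift (l : ℝ) (u : unitInterval) :
    coord pair (shift pair l u) = Int.fract (coord pair u + l) := by
  simp [coord, shift, fracShift]

theorem shift_shift (l l' : ℝ) (u : unitInterval) :
    shift pair l' (shift pair l u) = shift pair (l + l') u := by
  have h : ∀ v : unitInterval, fracShift l' (fracShift l v) = fracShift (l + l') v := fun v => by
    refine Subtype.ext ?_
    simp only [fracShift]
    rw [Int.fract_eq_fract]
    refine ⟨-⌊(v : ℝ) + l⌋, ?_⟩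
    rw [Int.fract]
    push_cast
    ring
  simp [shift, h]

/-- The bound is needed because addition modulo one sends the endpoint `1` to `0`. -/
theorem shift_zero {u : unitInterval} (hu : coord pair u < 1) : shift pair 0 u = u := by
  have h : fracShift 0 (pair.symm u).1 = (pair.symm u).1 := Subtype.ext <| by
    simp only [fracShift, add_zero]
    exact Int.fract_eq_self.2 ⟨(pair.symm u).1.2.1, hu⟩
  simp [shift, h]

variable (pair) in
/-- The points whose first component lies in the open cell number `c` out of `N`. -/
def InCell (N c : ℕ) (u : unitInterval) : Prop :=
  (c : ℝ) < N * coord pair u ∧ N * coord pair u < c + 1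

/-- Before reduction modulo one the sum already lies in the cell `c'`, which is inside `[0,1)`;
there is no wrap-around. -/
theorem InCell.shift {N c c' : ℕ} (hc' : c' < N) {u : unitInterval} (h : InCell pair N c u) :
    InCell pair N c' (shift pair (((c' : ℝ) - c) / N) u) := by
  have hN : (0 : ℝ) < N := by exact_mod_cast (Nat.zero_le _).trans_lt hc'
  have hc1 : (c' : ℝ) + 1 ≤ N := by exact_mod_cast hc'
  have hmul : N * (coord pair u + ((c' : ℝ) - c) / N) = N * coord pair u + (c' - c) := by
    field_simp
  have hfr : Int.fract (coord pair u + ((c' : ℝ) - c) / N) = coord pair u + ((c' : ℝ) - c) / N := by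
    refine Int.fract_eq_self.2 ⟨?_, ?_⟩
    · refine le_of_mul_le_mul_left ?_ hN
      rw [hmul, mul_zero]
      linarith [h.1, Nat.cast_nonneg (α := ℝ) c']
    · refine lt_of_mul_lt_mul_left ?_ hN.le
      rw [hmul, mul_one]
      linarith [h.2]
  rw [InCell, coord_shift, hfr, hmul]
  constructor <;> linarith [h.1, h.2]

theorem InCell.coord_lt_one {N c : ℕ} (hc : c < N) {u : unitInterval} (h : InCell pair N c u) :
    coord pair u < 1 := by
  have hN : (0 : ℝ) < N := by exact_mod_cast (Nat.zero_le _).trans_lt hc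
  have hc1 : (c : ℝ) + 1 ≤ N := by exact_mod_cast hc
  refine lt_of_mul_lt_mul_left ?_ hN.le
  linarith [h.2]

/-- Open cells are disjoint, whereas the closed cells of `promoteSet` share endpoints. -/
theorem InCell.unique {N c c' : ℕ} {u : unitInterval} (h : InCell pair N c u)
    (h' : InCell pair N c' u) : c = c' := by
  have h1 : (c : ℝ) < c' + 1 := h.1.trans h'.2
  have h2 : (c' : ℝ) < c + 1 := h'.1.trans h.2
  have h3 : c < c' + 1 := by exact_mod_cast h1
  have h4 : c' < c + 1 := by exact_mod_cast h2
  omega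

variable (pair) in
/-- The sequences none of whose coordinates lies on the boundary of a cell. -/
def Generic (N : ℕ) (s : Seq) : Prop := ∀ n, ∀ z : ℤ, N * coord pair (s n) ≠ z

theorem Generic.permute {N : ℕ} {s : Seq} (h : Generic pair N s) (σ : Equiv.Perm ℕ) :
    Generic pair N (permute σ s) := fun _ => h _

/-- A rotation by a multiple of `1/N`, modulo one, changes `N` times the first component by an
integer. -/
theorem Generic.update_shift {N : ℕ} (hN : N ≠ 0) {s : Seq} (h : Generic pair N s) (m c c' : ℕ) :
    Generic pair N (Function.update s m (shift pair (((c' : ℝ) - c) / N) (s m))) := by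
  intro n z
  rcases eq_or_ne n m with rfl | hn
  · rw [Function.update_self, coord_shift, Int.fract]
    intro hz
    have hN' : (N : ℝ) ≠ 0 := by exact_mod_cast hN
    refine h n (z + N * ⌊coord pair (s n) + ((c' : ℝ) - c) / N⌋ - c' + c) ?_
    push_cast
    rw [← hz]
    field_simp
    ring
  · rw [Function.update_of_ne hn]
    exact h n z

theorem measurable_coord : Measurable (coord pair) := by unfold coord; fun_prop

/-- For each of the countably many pairs (coordinate, integer), the excluded points are the preimage
of at most one point of `[0,1]` under maps that pull null sets back to null sets. -/
theorem ae_generic (hpair : MeasurePreserving pair) {N : ℕ} (hN : N ≠ 0) :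
    ∀ᵐ x ∂spaceMeasure, Generic pair N x.2 := by
  refine ae_all_iff.2 fun n => ae_all_iff.2 fun z => ?_
  have hN' : (N : ℝ) ≠ 0 := by exact_mod_cast hN
  have h0 : ∀ᵐ v : unitInterval, (N : ℝ) * (v : ℝ) ≠ z := by
    refine (Set.Subsingleton.measure_zero ?_ volume : volume {v : unitInterval | ¬ _} = 0)
    intro a ha b hb
    simp only [ne_eq, not_not, Set.mem_ofPred_eq] at ha hb
    exact Subtype.ext (mul_left_cancel₀ hN' (ha.trans hb.symm))
  have h1 : ∀ᵐ v : unitInterval × unitInterval, (N : ℝ) * (v.1 : ℝ) ≠ z :=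
    Measure.quasiMeasurePreserving_fst.ae h0
  have h2 : ∀ᵐ u : unitInterval, (N : ℝ) * coord pair u ≠ z :=
    (hpair.symm pair).quasiMeasurePreserving.ae h1
  have h3 : ∀ᵐ s ∂seqMeasure, (N : ℝ) * coord pair (s n) ≠ z :=
    (measurePreserving_eval_infinitePi (fun _ : ℕ => (volume : Measure unitInterval))
      n).quasiMeasurePreserving.ae h2
  exact Measure.quasiMeasurePreserving_snd.ae h3

theorem measurableSet_inCell (N c : ℕ) : MeasurableSet {u | InCell pair N c u} :=
  (measurableSet_lt measurable_const (measurable_coord.const_mul _)).inter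
    (measurableSet_lt (measurable_coord.const_mul _) measurable_const)

theorem volume_inCell_ne_zero (hpair : MeasurePreserving pair) {N c : ℕ} (hc : c < N) :
    volume {u | InCell pair N c u} ≠ 0 := by
  have hN : (0 : ℝ) < N := by exact_mod_cast (Nat.zero_le _).trans_lt hc
  have hc1 : (c : ℝ) + 1 ≤ N := by exact_mod_cast hc
  have hc0 : (0 : ℝ) ≤ c := Nat.cast_nonneg c
  let a : unitInterval := ⟨c / N, by positivity, by rw [div_le_one hN]; linarith⟩
  let b : unitInterval := ⟨(c + 1) / N, by positivity, by rwa [div_le_one hN]⟩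
  have heq : {u | InCell pair N c u} = pair.symm ⁻¹' (Set.Ioo a b ×ˢ Set.univ) := by
    ext u
    simp only [InCell, Set.mem_ofPred_eq, Set.mem_preimage, Set.mem_prod, Set.mem_Ioo,
      Set.mem_univ, and_true, ← Subtype.coe_lt_coe, a, b, div_lt_iff₀ hN, lt_div_iff₀ hN, coord,
      mul_comm (N : ℝ)]
  rw [heq, (hpair.symm pair).measure_preimage
    (measurableSet_Ioo.prod MeasurableSet.univ).nullMeasurableSet, Measure.volume_eq_prod,
    Measure.prod_prod, unitInterval.volume_Ioo, measure_univ, mul_one]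
  simp only [ne_eq, ENNReal.ofReal_eq_zero, not_le, a, b, ← sub_div]
  have : (c : ℝ) + 1 - c = 1 := by ring
  rw [this]
  positivity

variable (pair) in
/-- The points over `z` whose first `k` coordinates lie in the cell number `c`. -/
def cellBox (N c k : ℕ) (z : ℤ) : Set Space :=
  {x | x.1 = z ∧ ∀ j : Fin k, InCell pair N c (x.2 j)}

theorem cellBox_eq (N c k : ℕ) (z : ℤ) : cellBox pair N c k z =
    {z} ×ˢ Set.pi ((Finset.range k : Finset ℕ) : Set ℕ) fun _ => {u | InCell pair N c u} := by
  ext x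
  simp only [cellBox, Set.mem_ofPred_eq, Set.mem_prod, Set.mem_singleton_iff, Set.mem_pi,
    Finset.coe_range, Set.mem_Iio]
  exact and_congr_right fun _ => ⟨fun h n hn => h ⟨n, hn⟩, fun h j => h j j.2⟩

theorem measurableSet_cellBox (N c k : ℕ) (z : ℤ) : MeasurableSet (cellBox pair N c k z) := by
  rw [cellBox_eq]
  exact (MeasurableSet.singleton z).prod
    (MeasurableSet.pi (Finset.countable_toSet _) fun _ _ => measurableSet_inCell N c)

theorem spaceMeasure_cellBox_ne_zero (hpair : MeasurePreserving pair) {N c : ℕ} (hc : c < N)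
    (k : ℕ) (z : ℤ) : spaceMeasure (cellBox pair N c k z) ≠ 0 := by
  rw [cellBox_eq, spaceMeasure, Measure.prod_prod, Measure.count_singleton, one_mul, seqMeasure,
    Measure.infinitePi_pi _ fun _ _ => measurableSet_inCell N c]
  exact Finset.prod_ne_zero_iff.2 fun _ _ => volume_inCell_ne_zero hpair hc

theorem permute_mem_cellBox {N c k : ℕ} {z : ℤ} (σ : Equiv.Perm (Fin k)) {x : Space}
    (hx : x ∈ cellBox pair N c k z) :
    (x.1, permute (extendPerm σ) x.2) ∈ cellBox pair N c k z := by
  refine ⟨hx.1, fun j => ?_⟩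
  simp only [permute, extendPerm_symm_apply]
  exact hx.2 _

/-- Word edges do not permute coordinates, so their promotions only rotate coordinate `0`, the one
of the head being moved. -/
theorem promoteMap_instr_one (l : ℝ) (z : ℤ) (x : Space) :
    promoteMap pair l (instr z 1) x =
      (x.1 + z, Function.update x.2 0 (shift pair l (x.2 0))) := by
  refine Prod.ext rfl (funext fun n => ?_)
  cases n with
  | zero => simp [promoteMap, cons, shift]
  | succ n => simp [promoteMap, cons, instr, permute_one, tail]

end Shift

/-! ### Words and automata -/

/-- The end-marker occurs once in the circular word. This locates a head that has not moved yet
without any knowledge of its coordinate. -/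
theorem letterAt_eq_star {w : List Bool} {i : Fin (w.length + 1)}
    (h : letterAt w i = Letter.star) : i = 0 := by
  cases i using Fin.cases with
  | zero => rfl
  | succ i => simp [letterAt] at h

theorem fst_mem_block_singleton {Ψ : Vertex ↪ ℤ} {v : Vertex} {x : Space} :
    x ∈ block Ψ {v} ↔ x.1 = Ψ v := by
  simp [block]

theorem mem_block_symbolVertices {Ψ : Vertex ↪ ℤ} {v : Vertex} {x : Space} (hx : x.1 = Ψ v) :
    x ∈ block Ψ symbolVertices ↔ v ∈ symbolVertices := by
  simp [block, hx]

theorem rej_notMem_symbolVertices : Vertex.rej ∉ symbolVertices := by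
  rintro ⟨_, _, h⟩
  cases h

theorem acc_notMem_symbolVertices : Vertex.acc ∉ symbolVertices := by
  rintro ⟨_, _, h⟩
  cases h

section Word

variable {Ψ : Vertex ↪ ℤ} {pair : unitInterval × unitInterval ≃ᵐ unitInterval}
  {w : List Bool} {N : ℕ}

/-- The representation of `w` defined by an injective renaming of its dialect. -/
noncomputable abbrev wordRep (Ψ : Vertex ↪ ℤ) (hpair : MeasurePreserving pair) (w : List Bool)
    (f : Fin (w.length + 1) ↪ Fin N) : Graphing Unit :=
  promote hpair ((wordGraphing Ψ w).rename f)

variable {hpair : MeasurePreserving pair} {f : Fin (w.length + 1) ↪ Fin N}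

theorem mem_wordRep_source {d : Dir} {i : Fin (w.length + 1)} {x : Space} :
    x ∈ (wordRep Ψ hpair w f).source (d, i) ↔ x.1 = Ψ (Vertex.sym (letterAt w i) d) ∧
      ((f i : ℕ) : ℝ) ≤ N * coord pair (x.2 0) ∧
      N * coord pair (x.2 0) ≤ ((f i : ℕ) : ℝ) + 1 :=
  and_congr_left fun _ => fst_mem_block_singleton

theorem wordRep_realiser {d : Dir} {i : Fin (w.length + 1)} {x : Space}
    (hx : x.1 = Ψ (Vertex.sym (letterAt w i) d)) :
    (wordRep Ψ hpair w f).realiser (d, i) x =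
      (Ψ (Vertex.sym (letterAt w (d.move i)) d.flip), Function.update x.2 0
        (shift pair ((((f (d.move i) : ℕ) : ℝ) - ((f i : ℕ) : ℝ)) / N) (x.2 0))) := by
  refine (promoteMap_instr_one _ _ x).trans (Prod.ext ?_ rfl)
  change x.1 + (_ - _) = _
  rw [hx]
  exact add_sub_cancel _ _

end Word

namespace Automaton

variable {k : ℕ} {M : Automaton k} {w : List Bool}

theorem Reachable.eq_initial (hinit : M.NeverReturnsToInit) {c : M.Config w}
    (hc : M.Reachable w c) (h : c.2 = M.init) : c = M.initial w := by
  rcases Relation.ReflTransGen.cases_tail hc with h' | ⟨b, _, _, _, i, d, ht, _⟩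
  · exact h'
  · exact absurd h (hinit _ ht)

instance : Finite M.Dialect :=
  haveI := M.finite_state
  inferInstance

/-! ### Sources and targets of the edges of `[M]` -/

section Edges

variable {s : Fin k → Letter} {q q' : M.State} {i : Fin k} {d' d : Dir} {a : Letter}
  {σ : Equiv.Perm (Fin k)}
  {ht : ((s, q), ((i, d'), q')) ∈ M.trans ∧ (q = M.init → s = fun _ => Letter.star)}

theorem targetVertex_of_accept (hq : q' = M.accept) :
    M.targetVertex (⟨((s, q), ((i, d'), q')), ht⟩, a, d, σ) = Vertex.acc := by
  simp [targetVertex, hq]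

theorem targetVertex_of_reject (hq : q' = M.reject) :
    M.targetVertex (⟨((s, q), ((i, d'), q')), ht⟩, a, d, σ) = Vertex.rej := by
  simp [targetVertex, hq, M.accept_ne_reject.symm]

theorem targetVertex_of_ne (hq : q' ≠ M.accept) (hq' : q' ≠ M.reject) :
    M.targetVertex (⟨((s, q), ((i, d'), q')), ht⟩, a, d, σ) = Vertex.sym (s i) d' := by
  simp [targetVertex, hq, hq']

variable [NeZero k]

theorem sourceVertex_of_init (hq : q = M.init) :
    M.sourceVertex (⟨((s, q), ((i, d'), q')), ht⟩, a, Dir.outward, σ) = Vertex.rej := by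
  simp [sourceVertex, hq]

theorem sourceVertex_of_ne (hq : q ≠ M.init) :
    M.sourceVertex (⟨((s, q), ((i, d'), q')), ht⟩, a, d, σ) = Vertex.sym (s (σ.symm 0)) d := by
  simp [sourceVertex, hq]

theorem sourceVertex_eq_rej
    (h : M.sourceVertex (⟨((s, q), ((i, d'), q')), ht⟩, a, d, σ) = Vertex.rej) : q = M.init := by
  by_contra hq
  rw [sourceVertex_of_ne hq] at h
  cases h

theorem sourceDialect_of_init (hq : q = M.init) :
    M.sourceDialect (⟨((s, q), ((i, d'), q')), ht⟩, a, d, σ) = M.homeDialect := by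
  simp [sourceDialect, hq]

theorem sourceDialect_of_ne (hq : q ≠ M.init) :
    M.sourceDialect (⟨((s, q), ((i, d'), q')), ht⟩, a, d, σ) =
      (q, σ, Function.update s (σ.symm 0) a) := by
  simp [sourceDialect, hq]

theorem targetDialect_of_reject (hq : q' = M.reject) :
    M.targetDialect (⟨((s, q), ((i, d'), q')), ht⟩, a, d, σ) = M.homeDialect := by
  simp [targetDialect, hq]

theorem targetDialect_of_ne (hq : q' ≠ M.accept) (hq' : q' ≠ M.reject) :
    M.targetDialect (⟨((s, q), ((i, d'), q')), ht⟩, a, d, σ) =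
      (q', Equiv.swap 0 (σ i) * σ, s) := by
  simp [targetDialect, hq, hq']

/-- The realiser and the stored permutation undergo the same transposition, so each head keeps the
value of its coordinate while head `i` comes to use coordinate `0`. -/
theorem headSwap_apply (j : Fin k) (y : Seq) :
    permute (M.headSwap (⟨((s, q), ((i, d'), q')), ht⟩, a, d, σ)) y
      ((Equiv.swap 0 (σ i) * σ) j : Fin k) = y (σ j) :=
  permute_swap_zero_apply _ _ y

end Edges

variable [NeZero k] {Ψ : Vertex ↪ ℤ}

theorem mem_encode_source {e : M.EncEdge} {x : Space} :
    x ∈ (M.encode Ψ).source e ↔ x.1 = Ψ (M.sourceVertex e) :=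
  fst_mem_block_singleton

theorem encode_realiser {e : M.EncEdge} {x : Space} (hx : x.1 = Ψ (M.sourceVertex e)) :
    (M.encode Ψ).realiser e x = (Ψ (M.targetVertex e), permute (M.headSwap e) x.2) := by
  refine Prod.ext ?_ rfl
  change x.1 + (_ - _) = _
  rw [hx]
  exact add_sub_cancel _ _

/-! ### From paths to computations: the accepting case -/

variable {pair : unitInterval × unitInterval ≃ᵐ unitInterval}
  {hpair : MeasurePreserving pair} {N : ℕ} {f : Fin (w.length + 1) ↪ Fin N}

theorem swap_mul_apply_self (σ : Equiv.Perm (Fin k)) (i : Fin k) :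
    (Equiv.swap 0 (σ i) * σ) i = 0 := by
  simp

/-- A path that starts with a transition fired by a computation and ends in `⟨r⟩` follows, on
generic points, a rejecting computation: the heads that have moved are where the coordinates say,
the others are still at position `0`. -/
theorem exists_reachable_reject (hinit : M.NeverReturnsToInit) :
    ∀ (l : List (JointEdge (M.encode Ψ) (wordRep Ψ hpair w f)))
      (p : Fin k → Fin (w.length + 1)) (q : M.State) (i : Fin k) (d' : Dir) (q' : M.State)
      (ht : ((fun j => letterAt w (p j), q), ((i, d'), q')) ∈ M.trans ∧
        (q = M.init → (fun j => letterAt w (p j)) = fun _ => Letter.star))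
      (a : Letter) (d : Dir) (σ : Equiv.Perm (Fin k)) (x : Space) (r : M.Dialect × Unit),
      M.Reachable w (p, q) → q ≠ M.accept → q ≠ M.reject →
      x.1 = Ψ (M.targetVertex (⟨_, ht⟩, a, d, σ)) → Generic pair N x.2 →
      (∀ j, p j = 0 ∨ InCell pair N (f (p j)) (x.2 ((Equiv.swap 0 (σ i) * σ) j : Fin k))) →
      List.IsChain Alternate (Sum.inl (⟨_, ht⟩, a, d, σ) :: l) →
      Leads l (M.targetDialect (⟨_, ht⟩, a, d, σ), ()) r →
      x ∈ pathDomain l → (pathMap l x).1 = Ψ Vertex.rej →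
      ∃ c : M.Config w, M.Reachable w c ∧ c.2 = M.reject := by
  intro l
  -- One step of the automaton is a word edge, which moves the head, followed by an edge of `[M]`,
  -- which fires the next transition.
  induction l using List.twoStepInduction with
  | nil =>
    intro p q i d' q' ht a d σ x r hreach hacc hrej hx _ _ _ _ _ hend
    have hstep : M.Step w (p, q) (Function.update p i (d'.move (p i)), q') :=
      ⟨hacc, hrej, i, d', ht.1, rfl⟩
    have hv : M.targetVertex (⟨_, ht⟩, a, d, σ) = Vertex.rej := Ψ.injective (hx.symm.trans hend)
    refine ⟨_, hreach.tail hstep, ?_⟩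
    by_contra hq'
    by_cases hq'' : q' = M.accept
    · rw [targetVertex_of_accept hq''] at hv
      cases hv
    · rw [targetVertex_of_ne hq'' hq'] at hv
      cases hv
  | singleton e =>
    intro p q i d' q' ht a d σ x r _ _ _ _ _ _ hchain _ hdom hend
    rcases e with e | ⟨d₁, j⟩
    · exact absurd rfl (List.isChain_cons_cons.1 hchain).1
    · have h1 := (mem_wordRep_source.1 hdom.1).1
      have h2 := congrArg Prod.fst (wordRep_realiser (hpair := hpair) (f := f) h1)
      cases Ψ.injective (h2.symm.trans hend)
  | cons_cons e e₂ l ih =>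
    intro p q i d' q' ht a d σ x r hreach hacc hrej hx hgen hcell hchain hleads hdom hend
    rcases e with e | ⟨d₁, j⟩
    · exact absurd rfl (List.isChain_cons_cons.1 hchain).1
    rcases e₂ with ⟨⟨⟨⟨s₂, q₂⟩, ⟨⟨i₂, d₂'⟩, q₂'⟩⟩, ht₂⟩, a₂, d₂, σ₂⟩ | e₂
    swap
    · exact absurd rfl (List.isChain_cons_cons.1 hchain.tail).1
    have hstep : M.Step w (p, q) (Function.update p i (d'.move (p i)), q') :=
      ⟨hacc, hrej, i, d', ht.1, rfl⟩
    by_cases hq' : q' = M.reject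
    · exact ⟨_, hreach.tail hstep, hq'⟩
    obtain ⟨hx1, hx2⟩ := mem_wordRep_source.1 hdom.1
    have hv := Ψ.injective (hx.symm.trans hx1)
    by_cases hq'' : q' = M.accept
    · rw [targetVertex_of_accept hq''] at hv
      cases hv
    rw [targetVertex_of_ne hq'' hq', Vertex.sym.injEq] at hv
    obtain ⟨hlet, rfl⟩ := hv
    have hN : N ≠ 0 := (f 0).pos.ne'
    -- The source of a promoted edge is a closed cell; genericity excludes its endpoints.
    have hstrict : InCell pair N (f j) (x.2 0) := by
      refine ⟨lt_of_le_of_ne hx2.1 fun h => hgen 0 (f j : ℕ) ?_,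
        lt_of_le_of_ne hx2.2 fun h => hgen 0 ((f j : ℕ) + 1) ?_⟩
      · rw [← h]; simp
      · rw [h]; simp
    -- The word edge must start from the actual position of head `i`. For a head only known to be at
    -- `0`, the letter `⋆` decides; otherwise its cell does.
    have hji : j = p i := by
      rcases hcell i with h | h
      · rw [h] at hlet ⊢
        exact letterAt_eq_star hlet.symm
      · rw [swap_mul_apply_self] at h
        exact f.injective (Fin.ext (hstrict.unique h))
    subst hji
    set σ' := Equiv.swap 0 (σ i) * σ with hσ'
    have hσi : σ' i = 0 := swap_mul_apply_self σ i
    have hσi' : σ'.symm 0 = i := by rw [Equiv.symm_apply_eq, hσi]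
    obtain ⟨r₁, ⟨_, rfl⟩, r₂, ⟨hm, rfl⟩, hleads'⟩ := hleads
    have hm' : (q', σ', fun j => letterAt w (p j)) =
        M.sourceDialect (⟨((s₂, q₂), ((i₂, d₂'), q₂')), ht₂⟩, a₂, d₂, σ₂) :=
      (targetDialect_of_ne (ht := ht) (a := a) (d := d) hq'' hq').symm.trans hm
    have hq₂ : q₂ ≠ M.init := by
      intro h
      rw [sourceDialect_of_init h] at hm'
      exact hinit _ ht.1 (congrArg Prod.fst hm')
    rw [sourceDialect_of_ne hq₂, Prod.mk.injEq, Prod.mk.injEq] at hm'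
    obtain ⟨rfl, rfl, hs⟩ := hm'
    have hreal := wordRep_realiser (hpair := hpair) (f := f) hx1
    have hdom₂ := hdom.2
    set y := (wordRep Ψ hpair w f).realiser (d', p i) x with hy
    have hdom₂' : y ∈ (M.encode Ψ).source _ ∧ (M.encode Ψ).realiser _ y ∈ pathDomain l := hdom₂
    have hy1 := mem_encode_source.1 hdom₂'.1
    have hv₂ := hy1
    rw [hreal, sourceVertex_of_ne hq₂, hσi'] at hv₂
    have hv₃ := Ψ.injective hv₂
    rw [Vertex.sym.injEq] at hv₃
    -- The new letter of head `i` is read off the vertex that the word edge reaches; the other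
    -- letters come from the dialect.
    have hs₂ : s₂ = fun j => letterAt w (Function.update p i (d'.move (p i)) j) := by
      funext j
      rcases eq_or_ne j i with rfl | hj
      · rw [Function.update_self, hv₃.1]
      · have := congrFun hs j
        rw [hσi', Function.update_of_ne hj] at this
        rw [Function.update_of_ne hj, this]
    subst hs₂
    have hreal₂ := encode_realiser hy1
    refine ih (Function.update p i (d'.move (p i))) q' i₂ d₂' q₂' ht₂ a₂ d₂ σ'
      ((M.encode Ψ).realiser _ y) r (hreach.tail hstep) hq'' hq' (by rw [hreal₂]) ?_ ?_
      hchain.tail.tail hleads' hdom₂'.2 hend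
    · rw [hreal₂, hreal]
      exact (hgen.update_shift hN 0 _ _).permute _
    · intro j
      rw [hreal₂]
      dsimp only
      rw [headSwap_apply, hreal]
      dsimp only
      rcases eq_or_ne j i with rfl | hj
      · right
        rw [hσi, Function.update_self]
        exact hstrict.shift (f _).2
      · rw [Function.update_of_ne hj, Function.update_of_ne]
        · exact hcell j
        · intro h
          exact hj (σ'.injective ((Fin.ext h).trans hσi.symm))

/-- Only edges out of `init` start from `⟨r⟩`, and they read `⋆` everywhere: such a path begins like
a computation from the initial configuration. -/
theorem not_returns_of_accepts (hinit : M.NeverReturnsToInit) (h : M.Accepts w)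
    {l : List (JointEdge (M.encode Ψ) (wordRep Ψ hpair w f))} (hl : l ≠ [])
    (hchain : l.IsChain Alternate) {p r : M.Dialect × Unit} (hleads : Leads l p r) {x : Space}
    (hgen : Generic pair N x.2) (hx : x.1 = Ψ Vertex.rej) (hdom : x ∈ pathDomain l) :
    (pathMap l x).1 ≠ Ψ Vertex.rej := by
  intro hend
  rcases l with _ | ⟨⟨⟨⟨⟨s, q⟩, ⟨⟨i, d'⟩, q'⟩⟩, ht⟩, a, d, σ⟩ | ⟨d, j⟩, l⟩
  · exact hl rfl
  · have hx1 := mem_encode_source.1 hdom.1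
    have hq : q = M.init := sourceVertex_eq_rej (Ψ.injective (hx1.symm.trans hx))
    subst hq
    obtain rfl : s = fun j => letterAt w ((fun _ => 0 : Fin k → Fin (w.length + 1)) j) := ht.2 rfl
    have hreal := encode_realiser hx1
    obtain ⟨r₁, ⟨_, rfl⟩, hleads'⟩ := hleads
    refine h (exists_reachable_reject hinit l (fun _ => 0) M.init i d' q' ht a d σ
      ((M.encode Ψ).realiser _ x) r .refl M.init_ne_accept M.init_ne_reject (by rw [hreal]) ?_
      (fun _ => Or.inl rfl) hchain hleads' hdom.2 hend)
    rw [hreal]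
    exact hgen.permute _
  · cases Ψ.injective (hx.symm.trans (mem_wordRep_source.1 hdom.1).1)

/-- Every other edge of an alternating cycle is the identity of `⟨r⟩`, so that a cycle followed
from a generic point would contain a path from `⟨r⟩` to `⟨r⟩`. -/
theorem measurement_eq_zero_of_accepts (hinit : M.NeverReturnsToInit) (h : M.Accepts w) :
    measurement (execute (M.encode Ψ) (wordRep Ψ hpair w f)) (rejectIdentity Ψ) = 0 := by
  refine measurement_eq_zero_of_null fun l hl => ?_
  have hN : N ≠ 0 := (f 0).pos.ne'
  obtain ⟨hne, hcyc, -⟩ := hl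
  obtain ⟨e₁, l, rfl⟩ := List.exists_cons_of_ne_nil hne
  rw [Cycle.chain_coe_cons] at hcyc
  -- If the cycle begins with an edge of the execution, the path considered is the next such edge.
  -- It starts at `e₁.realiser x`, as the identity in between moves nothing.
  have hae : ∀ᵐ x ∂spaceMeasure, Generic pair N (e₁.realiser x).2 :=
    e₁.measurePreserving.quasiMeasurePreserving.ae (ae_generic hpair hN)
  have key : ∀ᵐ x ∂spaceMeasure, x ∉ cycleSupport (e₁ :: l) := by
    filter_upwards [hae, ae_generic hpair hN] with x hgen₁ hgen hx
    -- Two rounds are taken because a cycle of length two starting with an execution edge exhibits a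
    -- path between two identities only in its second round.
    have hdom : x ∈ pathDomain ((e₁ :: l) ++ (e₁ :: l)) := mem_pathDomain_append.2 ⟨hx 0, hx 1⟩
    have hchain : List.IsChain Alternate ((e₁ :: l) ++ (e₁ :: l)) :=
      List.isChain_split.2 ⟨hcyc, hcyc.left_of_append (l₁ := e₁ :: l)⟩
    have hex : ∃ e₂ e₃ e₄ l', (e₁ :: l) ++ (e₁ :: l) = e₁ :: e₂ :: e₃ :: e₄ :: l' := by
      rcases l with _ | ⟨e₂, _ | ⟨e₃, _ | ⟨e₄, l⟩⟩⟩
      · simp [Alternate] at hcyc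
      all_goals exact ⟨_, _, _, _, rfl⟩
    obtain ⟨e₂, e₃, e₄, l', heq⟩ := hex
    rw [heq] at hdom hchain
    have hreturn : ∀ (P : AltPath (M.encode Ψ) (wordRep Ψ hpair w f)) (y : Space),
        Generic pair N y.2 → y.1 = Ψ Vertex.rej → y ∈ pathDomain P.edges →
        (pathMap P.edges y).1 ≠ Ψ Vertex.rej := fun P y h1 h2 h3 =>
      not_returns_of_accepts hinit h P.ne_nil P.alternating P.leads h1 h2 h3
    simp only [List.isChain_cons_cons] at hchain
    obtain ⟨h12, h23, h34, -⟩ := hchain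
    obtain ⟨hd1, hd2, hd3, hd4, -⟩ := hdom
    rcases e₁ with P | u
    · rcases e₂ with e₂ | u
      · simp [Alternate] at h12
      rcases e₃ with P | e₃
      swap
      · simp [Alternate] at h23
      rcases e₄ with e₄ | u'
      · simp [Alternate] at h34
      exact hreturn P _ hgen₁ (fst_mem_block_singleton.1 hd2) hd3.1.1
        (fst_mem_block_singleton.1 hd4)
    · rcases e₂ with P | e₂
      swap
      · simp [Alternate] at h12
      rcases e₃ with e₃ | u'
      · simp [Alternate] at h23
      exact hreturn P x hgen (fst_mem_block_singleton.1 hd1) hd2.1.1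
        (fst_mem_block_singleton.1 hd3)
  rw [ae_iff] at key
  simpa using key

end Automaton

/-! ### From computations to paths -/

namespace Automaton

variable {k : ℕ} {M : Automaton k} {w : List Bool}
  {pair : unitInterval × unitInterval ≃ᵐ unitInterval} {N : ℕ}

/-- The first `k` coordinates are moved from the cell of position `0` to those of the given
positions. -/
noncomputable def placeHeads (pair : unitInterval × unitInterval ≃ᵐ unitInterval)
    (f : Fin (w.length + 1) ↪ Fin N) (p : Fin k → Fin (w.length + 1)) (s : Seq) : Seq := fun n =>
  if h : n < k then shift pair ((((f (p ⟨n, h⟩) : ℕ) : ℝ) - ((f 0 : ℕ) : ℝ)) / N) (s n) else s n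

variable {f : Fin (w.length + 1) ↪ Fin N}

theorem placeHeads_apply (p : Fin k → Fin (w.length + 1)) (s : Seq) (j : Fin k) :
    placeHeads pair f p s j =
      shift pair ((((f (p j) : ℕ) : ℝ) - ((f 0 : ℕ) : ℝ)) / N) (s j) := by
  simp [placeHeads]

theorem placeHeads_apply_of_le (p : Fin k → Fin (w.length + 1)) (s : Seq) {n : ℕ} (h : k ≤ n) :
    placeHeads pair f p s n = s n := by
  simp [placeHeads, not_lt.2 h]

theorem placeHeads_zero {s : Seq} (hs : ∀ j : Fin k, InCell pair N (f 0) (s j)) :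
    placeHeads pair f (fun _ : Fin k => 0) s = s := by
  funext n
  by_cases h : n < k
  · rw [placeHeads_apply _ s ⟨n, h⟩, sub_self, zero_div,
      shift_zero ((hs ⟨n, h⟩).coord_lt_one (f 0).2)]
  · exact placeHeads_apply_of_le _ s (not_lt.1 h)

variable [NeZero k]

theorem permute_placeHeads_zero {σ : Equiv.Perm (Fin k)} {i : Fin k} (hσ : σ i = 0)
    (p : Fin k → Fin (w.length + 1)) (s : Seq) :
    permute (extendPerm σ) (placeHeads pair f p s) 0 =
      shift pair ((((f (p i) : ℕ) : ℝ) - ((f 0 : ℕ) : ℝ)) / N) (s i) := by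
  have h := extendPerm_symm_apply σ 0
  rw [Fin.val_zero, ← hσ, Equiv.symm_apply_apply] at h
  rw [permute, h, placeHeads_apply]

/-- Moving the head that uses the coordinate `0`. -/
theorem update_permute_placeHeads {σ : Equiv.Perm (Fin k)} {i : Fin k} (hσ : σ i = 0)
    (p : Fin k → Fin (w.length + 1)) (j : Fin (w.length + 1)) (s : Seq) :
    Function.update (permute (extendPerm σ) (placeHeads pair f p s)) 0
        (shift pair ((((f j : ℕ) : ℝ) - ((f (p i) : ℕ) : ℝ)) / N)
          (permute (extendPerm σ) (placeHeads pair f p s) 0)) =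
      permute (extendPerm σ) (placeHeads pair f (Function.update p i j) s) := by
  funext n
  rcases eq_or_ne n 0 with rfl | hn
  · rw [Function.update_self, permute_placeHeads_zero hσ, permute_placeHeads_zero hσ, shift_shift,
      Function.update_self]
    congr 1
    ring
  · rw [Function.update_of_ne hn]
    by_cases h : n < k
    · have h1 := extendPerm_symm_apply σ ⟨n, h⟩
      have hne : σ.symm ⟨n, h⟩ ≠ i := by
        rw [Ne, Equiv.symm_apply_eq, hσ, Fin.ext_iff]
        simpa using hn
      simp only [permute]
      rw [h1, placeHeads_apply, placeHeads_apply, Function.update_of_ne hne]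
    · have h1 : (extendPerm σ).symm n = n := by
        rw [Equiv.symm_apply_eq, extendPerm_apply_of_le _ (not_lt.1 h)]
      simp only [permute]
      rw [h1, placeHeads_apply_of_le _ _ (not_lt.1 h), placeHeads_apply_of_le _ _ (not_lt.1 h)]

variable {Ψ : Vertex ↪ ℤ} {hpair : MeasurePreserving pair}

/-- A computation is followed by a path starting from `⟨r⟩`, which permutes the coordinates of the
points whose heads are at position `0` besides moving the heads. The letter `a` carried by the
first edge is arbitrary. -/
theorem exists_path_of_reachable (hinit : M.NeverReturnsToInit) {c : M.Config w}
    (hc : M.Reachable w c) : c.2 ≠ M.accept → c.2 ≠ M.reject → ∀ {i : Fin k} {d' : Dir} {q' : M.State}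
      (ht : ((fun j => letterAt w (c.1 j), c.2), ((i, d'), q')) ∈ M.trans ∧
        (c.2 = M.init → (fun j => letterAt w (c.1 j)) = fun _ => Letter.star)),
    ∃ (t₀ : {t : ((Fin k → Letter) × M.State) × ((Fin k × Dir) × M.State) //
        t ∈ M.trans ∧ (t.1.2 = M.init → t.1.1 = fun _ => Letter.star)})
      (rest : List (JointEdge (M.encode Ψ) (wordRep Ψ hpair w f))) (σ : Equiv.Perm (Fin k)),
      ∀ a : Letter, ∃ L : List (JointEdge (M.encode Ψ) (wordRep Ψ hpair w f)),
        L = Sum.inl (t₀, a, Dir.outward, 1) :: rest ∧ L.IsChain Alternate ∧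
        (∀ e ∈ L.getLast?, e.isLeft = true) ∧
        Leads L (M.homeDialect, ()) (M.targetDialect (⟨_, ht⟩, a, Dir.outward, σ), ()) ∧
        ∀ x ∈ cellBox pair N (f 0) k (Ψ Vertex.rej), x ∈ pathDomain L ∧
          pathMap L x = (Ψ (M.targetVertex (⟨_, ht⟩, a, Dir.outward, σ)),
            permute (extendPerm (Equiv.swap 0 (σ i) * σ)) (placeHeads pair f c.1 x.2)) := by
  induction hc with
  | refl =>
    intro _ _ i d' q' ht
    refine ⟨⟨_, ht⟩, [], 1, fun a => ⟨_, rfl, List.isChain_singleton _,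
      fun e he => by cases he; rfl,
      ⟨_, ⟨(sourceDialect_of_init (ht := ht) (a := a) (d := Dir.outward) rfl).symm, rfl⟩, rfl⟩, fun x hx => ?_⟩⟩
    have hsrc : x.1 = Ψ (M.sourceVertex (⟨_, ht⟩, a, Dir.outward, 1)) :=
      hx.1.trans (congrArg Ψ (sourceVertex_of_init (M := M) (ht := ht) rfl).symm)
    refine ⟨⟨mem_encode_source.2 hsrc, trivial⟩, (encode_realiser hsrc).trans ?_⟩
    refine Prod.ext rfl ?_
    change permute (Equiv.swap 0 (i : ℕ)) x.2 = _
    rw [mul_one, extendPerm_swap, Fin.val_zero]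
    change _ = permute _ (placeHeads pair f (fun _ => 0) x.2)
    rw [placeHeads_zero hx.2]
    rfl
  | @tail b c hb hstep ih =>
    intro hacc hrej i d' q' ht
    obtain ⟨p, q⟩ := b
    obtain ⟨p₁, q₁⟩ := c
    obtain ⟨hacc₀, hrej₀, i₁, d₁, ht₁, hp₁⟩ := hstep
    dsimp only at ht₁ hp₁ ht ih hacc hrej hacc₀ hrej₀
    subst hp₁
    -- The state `init` occurs only in the initial configuration, so the fired transition is among
    -- the encoded ones.
    have hs₁ : q = M.init → (fun j => letterAt w (p j)) = fun _ => Letter.star := fun hq => by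
      have := congrArg Prod.fst (Reachable.eq_initial hinit hb hq)
      dsimp only at this
      rw [this]
      rfl
    have hq₁ : q₁ ≠ M.init := hinit _ ht₁
    obtain ⟨t₀, rest, σ, hL⟩ := ih hacc₀ hrej₀ ⟨ht₁, hs₁⟩
    set σ' := Equiv.swap 0 (σ i₁) * σ with hσ'
    have hσi : σ' i₁ = 0 := swap_mul_apply_self σ i₁
    have hσi' : σ'.symm 0 = i₁ := by rw [Equiv.symm_apply_eq, hσi]
    let e₁ : JointEdge (M.encode Ψ) (wordRep Ψ hpair w f) := Sum.inr (d₁, p i₁)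
    -- The letter is the one that head `i₁` has just left, still stored in the dialect; the
    -- direction is the side from which the word edge enters. The target and the transposition of an
    -- edge depend on neither, so the conclusion may be stated with `a` and `outward`.
    let e : M.EncEdge := (⟨_, ht⟩, letterAt w (p i₁), d₁.flip, σ')
    refine ⟨t₀, rest ++ [e₁, Sum.inl e], σ', fun a => ?_⟩
    obtain ⟨L, hLeq, hchain, hlast, hleads, hpath⟩ := hL a
    refine ⟨L ++ [e₁, Sum.inl e], by rw [hLeq]; rfl, ?_, ?_, ?_, ?_⟩
    · refine List.isChain_append.2 ⟨hchain, List.isChain_pair.2 Bool.false_ne_true, ?_⟩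
      intro x hx y hy
      cases hy
      rw [Alternate, hlast x hx]
      exact Bool.true_eq_false_eq_False
    · intro x hx
      rw [List.getLast?_append] at hx
      cases hx
      rfl
    · refine hleads.append ⟨_, ⟨rfl, rfl⟩, _, ⟨?_, rfl⟩, rfl⟩
      refine (targetDialect_of_ne (ht := ⟨ht₁, hs₁⟩) (a := a) (d := Dir.outward) hacc hrej).trans
        ((sourceDialect_of_ne (ht := ht) (d := d₁.flip) hq₁).trans ?_).symm
      refine Prod.ext rfl (Prod.ext rfl (funext fun j => ?_))
      dsimp only
      rw [hσi']
      rcases eq_or_ne j i₁ with rfl | hj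
      · rw [Function.update_self]
      · rw [Function.update_of_ne hj, Function.update_of_ne hj]
    · intro x hx
      obtain ⟨hdom, hmap⟩ := hpath x hx
      rw [targetVertex_of_ne hacc hrej] at hmap
      set y := pathMap L x with hy
      have hy1 : y.1 = Ψ (Vertex.sym (letterAt w (p i₁)) d₁) := congrArg Prod.fst hmap
      have hy2 : y.2 = permute (extendPerm σ') (placeHeads pair f p x.2) := congrArg Prod.snd hmap
      have hcell : InCell pair N (f (p i₁)) (y.2 0) := by
        rw [hy2, permute_placeHeads_zero hσi]
        exact (hx.2 i₁).shift (f (p i₁)).2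
      have hsrc : y ∈ (wordRep Ψ hpair w f).source (d₁, p i₁) :=
        mem_wordRep_source.2 ⟨hy1, hcell.1.le, hcell.2.le⟩
      have hreal := wordRep_realiser (hpair := hpair) (f := f) hy1
      rw [hy2, update_permute_placeHeads hσi] at hreal
      set z := (wordRep Ψ hpair w f).realiser (d₁, p i₁) y with hz
      have hz1 : z.1 = Ψ (M.sourceVertex e) := by
        rw [hreal, sourceVertex_of_ne hq₁]
        dsimp only
        rw [hσi', Function.update_self]
      have hreal₂ := encode_realiser hz1
      refine ⟨mem_pathDomain_append.2 ⟨hdom, hsrc, mem_encode_source.2 hz1, trivial⟩, ?_⟩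
      rw [pathMap_append]
      refine hreal₂.trans (Prod.ext rfl ?_)
      change permute (Equiv.swap 0 (σ' i : ℕ)) z.2 = _
      rw [hreal, permute_permute, extendPerm_mul _ σ', extendPerm_swap, Fin.val_zero]

end Automaton

/-! ### The rejecting case and the orthogonality dichotomy -/

namespace Automaton

variable {k : ℕ} [NeZero k] {M : Automaton k} {w : List Bool}
  {pair : unitInterval × unitInterval ≃ᵐ unitInterval} {N : ℕ} {Ψ : Vertex ↪ ℤ}
  {hpair : MeasurePreserving pair} {f : Fin (w.length + 1) ↪ Fin N}

/-- The first edge of a rejecting path carries an arbitrary letter, so that there are several such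
paths with the same action, and infinitely many circuits. -/
theorem measurement_eq_top_of_not_accepts (hinit : M.NeverReturnsToInit)
    (hrep : M.RepositionsHeads) (h : ¬ M.Accepts w) :
    measurement (execute (M.encode Ψ) (wordRep Ψ hpair w f)) (rejectIdentity Ψ) = ⊤ := by
  obtain ⟨c', hc', hrej'⟩ := not_not.1 h
  rcases Relation.ReflTransGen.cases_tail hc' with h' | ⟨⟨p, q⟩, hb, hstep⟩
  · rw [h'] at hrej'
    exact absurd hrej' M.init_ne_reject
  -- These are the positions before the last step; its move is never carried out, since the edge of
  -- a rejecting transition leads directly to `⟨r⟩`.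
  have hp : p = fun _ => 0 := funext (hrep w _ _ hb hstep (Or.inr hrej'))
  obtain ⟨hacc, hrej, i, d', ht, -⟩ := hstep
  subst hp
  obtain ⟨t₀, rest, σ, hL⟩ := exists_path_of_reachable (Ψ := Ψ) (hpair := hpair) (f := f) hinit hb
    hacc hrej ⟨ht, fun _ => rfl⟩
  set τ := Equiv.swap 0 (σ i) * σ with hτ
  set E := cellBox pair N (f 0) k (Ψ Vertex.rej) with hE
  have hE0 : spaceMeasure E ≠ 0 := spaceMeasure_cellBox_ne_zero hpair (f 0).2 k _
  have hP : ∀ a : Letter, ∃ P : AltPath (M.encode Ψ) (wordRep Ψ hpair w f),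
      P.start = (M.homeDialect, ()) ∧ P.finish = (M.homeDialect, ()) ∧
      P.edges = Sum.inl (t₀, a, Dir.outward, 1) :: rest ∧
      ∀ x ∈ E, x ∈ pathDomain P.edges ∧
        pathMap P.edges x = (x.1, permute (extendPerm τ) x.2) := by
    intro a
    obtain ⟨L, hLeq, hchain, -, hleads, hpath⟩ := hL a
    rw [targetDialect_of_reject hrej'] at hleads
    refine ⟨⟨_, _, L, by rw [hLeq]; exact List.cons_ne_nil _ _, hchain, hleads,
      (pos_iff_ne_zero.2 hE0).trans_le (measure_mono fun x hx => (hpath x hx).1)⟩,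
      rfl, rfl, hLeq, fun x hx => ⟨(hpath x hx).1, (hpath x hx).2.trans (Prod.ext ?_ ?_)⟩⟩
    · rw [targetVertex_of_reject hrej']
      exact hx.1.symm
    · exact congrArg (permute _) (placeHeads_zero hx.2)
  obtain ⟨A, hA1, hA2, hA3, hA4⟩ := hP Letter.star
  obtain ⟨B, hB1, hB2, hB3, hB4⟩ := hP (Letter.bit true)
  have hAB : A ≠ B := by
    rintro rfl
    have := (List.cons.inj (hA3.symm.trans hB3)).1
    simp at this
  have hout : ∀ x ∈ E, x ∈ ((M.encode Ψ).support ∩ (wordRep Ψ hpair w f).support)ᶜ := by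
    intro x hx hx'
    have hx2 : ((x.1, tail x.2) : Space) ∈ block Ψ symbolVertices := hx'.2
    exact rej_notMem_symbolVertices ((mem_block_symbolVertices hx.1).1 hx2)
  have hmaps : Set.MapsTo (fun x : Space => (x.1, permute (extendPerm τ) x.2)) E E :=
    fun x hx => permute_mem_cellBox τ hx
  have hmem : ∀ P : AltPath (M.encode Ψ) (wordRep Ψ hpair w f), (∀ x ∈ E, x ∈ pathDomain P.edges ∧
      pathMap P.edges x = (x.1, permute (extendPerm τ) x.2)) →
      ∀ x ∈ E, x ∈ (execute (M.encode Ψ) (wordRep Ψ hpair w f)).source P ∧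
        (execute (M.encode Ψ) (wordRep Ψ hpair w f)).realiser P x =
          (x.1, permute (extendPerm τ) x.2) := by
    intro P h4 x hx
    refine ⟨⟨⟨(h4 x hx).1, hout x hx⟩, ?_⟩, (h4 x hx).2⟩
    rw [Set.mem_preimage, (h4 x hx).2]
    exact hout _ (hmaps hx)
  have hiter : ∀ (n : ℕ) (x : Space), (fun x : Space => (x.1, permute (extendPerm τ) x.2))^[n] x =
      (x.1, permute (extendPerm (τ ^ n)) x.2) := by
    intro n
    induction n with
    | zero =>
      intro x
      rw [pow_zero, extendPerm_one]
      rfl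
    | succ n ih =>
      intro x
      rw [Function.iterate_succ_apply, ih, permute_permute, ← extendPerm_mul, pow_succ]
  have hmoves : ∀ P : AltPath (M.encode Ψ) (wordRep Ψ hpair w f),
      P.start = (M.homeDialect, ()) → P.finish = (M.homeDialect, ()) →
      JointEdge.Moves (F := execute (M.encode Ψ) (wordRep Ψ hpair w f)) (G := rejectIdentity Ψ)
        (Sum.inl P) ((M.homeDialect, ()), ()) ((M.homeDialect, ()), ()) :=
    fun P h1 h2 => ⟨h1.symm, Prod.ext h2.symm rfl⟩
  have hweight : ∀ P : AltPath (M.encode Ψ) (wordRep Ψ hpair w f),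
      (execute (M.encode Ψ) (wordRep Ψ hpair w f)).weight P = 1 := fun P =>
    pathWeight_eq_one fun e _ => by cases e <;> rfl
  -- The common action of both paths permutes `k` coordinates by `τ`, so the order of `τ` serves as
  -- the period `m`.
  refine measurement_eq_top (A := A) (B := B) hAB (I := ()) (hmoves A hA1 hA2) (hmoves B hB1 hB2)
    ⟨rfl, rfl⟩ (hweight A) (hweight B) rfl (measurableSet_cellBox _ _ _ _) hE0 hmaps
    (orderOf_pos τ) (fun x _ => ?_) (hmem A hA4) (hmem B hB4)
    fun x hx => ⟨fst_mem_block_singleton.2 hx.1, rfl⟩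
  rw [hiter, pow_orderOf_eq_one, extendPerm_one]
  rfl

theorem execute_support :
    (execute (M.encode Ψ) (wordRep Ψ hpair w f)).support = (rejectIdentity Ψ).support := by
  ext x
  change (x ∈ block Ψ Set.univ ∨ ((x.1, tail x.2) : Space) ∈ block Ψ symbolVertices) ∧
    ¬ (x ∈ block Ψ Set.univ ∧ ((x.1, tail x.2) : Space) ∈ block Ψ symbolVertices) ↔
      x ∈ block Ψ {Vertex.acc, Vertex.rej}
  constructor
  · rintro ⟨h | h, h'⟩
    · obtain ⟨v, -, hv⟩ := h
      refine ⟨v, ?_, hv⟩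
      cases v with
      | sym a d => exact absurd ⟨⟨_, trivial, hv⟩, ⟨_, ⟨a, d, rfl⟩, hv⟩⟩ h'
      | acc => exact Or.inl rfl
      | rej => exact Or.inr rfl
    · exact absurd ⟨block_mono Ψ (Set.subset_univ _) h, h⟩ h'
  · rintro ⟨v, hv, hx⟩
    refine ⟨Or.inl ⟨v, trivial, hx⟩, fun h => ?_⟩
    have := (mem_block_symbolVertices (x := (x.1, tail x.2)) hx.symm).1 h.2
    rcases hv with rfl | rfl
    · exact acc_notMem_symbolVertices this
    · exact rej_notMem_symbolVertices this

/-- The wager of the execution vanishes, no weight being marked. -/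
theorem measurement_execute (ζ : ℝ) :
    ((M.machine Ψ).execute (Project.ofGraphing 0 (wordRep Ψ hpair w f))).measurement
        (Project.ofGraphing (ζ : EReal) (rejectIdentity Ψ)) =
      (ζ : EReal) + (measurement (execute (M.encode Ψ) (wordRep Ψ hpair w f))
        (rejectIdentity Ψ) : EReal) := by
  have h0 : measurement (M.encode Ψ) (wordRep Ψ hpair w f) = 0 :=
    measurement_eq_zero_of_weight (fun _ => rfl) fun _ => rfl
  simp [Project.measurement, Project.execute, machine, Project.ofGraphing, Project.total,
    Slice.execute, h0]

/-- The measurement is `ζ + 0` or `ζ + ∞`. The criterion involves neither `ζ` nor the renaming `f`,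
which makes the two languages agree. -/
theorem orthogonal_iff {ζ : ℝ} (hζ : ζ ≠ 0) (hinit : M.NeverReturnsToInit)
    (hrep : M.RepositionsHeads) :
    ((M.machine Ψ).execute (Project.ofGraphing 0 (wordRep Ψ hpair w f))).Orthogonal
      (Project.ofGraphing (ζ : EReal) (rejectIdentity Ψ)) ↔ M.Accepts w := by
  rw [Project.Orthogonal, measurement_execute]
  by_cases h : M.Accepts w
  · rw [measurement_eq_zero_of_accepts hinit h]
    refine iff_of_true ⟨execute_support (M := M) (hpair := hpair), ?_⟩ h
    simpa using hζ
  · rw [measurement_eq_top_of_not_accepts hinit hrep h]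
    refine iff_of_false (fun h' => h'.2.2.1 ?_) h
    simp

end Automaton

end IG

theorem mainTheorem11 (Ψ : IG.Vertex ↪ ℤ)
    (pair : unitInterval × unitInterval ≃ᵐ unitInterval)
    (hpair : MeasureTheory.MeasurePreserving pair)
    {k : ℕ} [NeZero k] (M : IG.Automaton k)
    (hinit : M.NeverReturnsToInit) (hrep : M.RepositionsHeads) (w : List Bool) :
    (w ∈ IG.existsLanguage Ψ hpair (IG.negTest Ψ) (M.machine Ψ) ↔ M.Accepts w) ∧
    (w ∈ IG.forallLanguage Ψ hpair (IG.negTest Ψ) (M.machine Ψ) ↔ M.Accepts w) := by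
  -- Since neither the test nor the set of representations is empty, the choice of quantifiers over
  -- them is immaterial.
  have hrepr : IG.Project.ofGraphing 0 (IG.wordRep Ψ hpair w (Function.Embedding.refl _)) ∈
      IG.representations Ψ hpair w := ⟨_, _, rfl⟩
  have htest : IG.Project.ofGraphing ((1 : ℝ) : EReal) (IG.rejectIdentity Ψ) ∈ IG.negTest Ψ :=
    ⟨1, one_ne_zero, rfl⟩
  refine ⟨⟨fun h => ?_, ?_⟩, ⟨fun h => ?_, ?_⟩⟩
  · obtain ⟨_, ⟨N, f, rfl⟩, horth⟩ := h _ htest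
    exact (IG.Automaton.orthogonal_iff one_ne_zero hinit hrep).1 horth
  · rintro h _ ⟨ζ, hζ, rfl⟩
    exact ⟨_, hrepr, (IG.Automaton.orthogonal_iff hζ hinit hrep).2 h⟩
  · exact (IG.Automaton.orthogonal_iff one_ne_zero hinit hrep).1 (h _ htest _ hrepr)
  · rintro h _ ⟨ζ, hζ, rfl⟩ _ ⟨N, f, rfl⟩
    exact (IG.Automaton.orthogonal_iff hζ hinit hrep).2 h
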